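/- Let $b>0$, $\mu>0$, $\nu\in[0,1)$ and $\gamma_0=\frac{\mu b}{4\pi(1-\nu)}$. Write $r^2=x^2+y^2$ and let $\arctan(x,y)\in(-\pi,\pi]$ be the principal argument of $y+ix$, whose branch cut is $\mathcal C=\{(0,y):y<0\}$. Consider the displacement and the stress of an edge dislocation at the origin with Burgers vector $(b,0)$, $$u_0=\frac{-b}{8\pi(1-\nu)}\begin{pmatrix}4(1-\nu)\arctan(x,y)-\frac{2xy}{r^2}\\ (1-2\nu)\log(x^2+y^2)+\frac{x^2-y^2}{r^2}\end{pmatrix},\qquad \sigma_0=\frac{2\gamma_0}{r^4}\begin{pmatrix}-y(3x^2+y^2)&x(x^2-y^2)\\x(x^2-y^2)&y(x^2-y^2)\end{pmatrix},$$ and let $\beta_0=\nabla u_0$ be the regular part of the distributional gradient (the classical gradient off $\mathcal C$). For $h>0$ let $\Omega_h=\mathbb R\times[-\pi h,\pi h)$ and $e_2=(0,1)$. For $z,z'\in\mathbb R^2$ let $$q^{\rm per}_{z,z'}(\zeta)=\frac12\sum_{n,n'\in\mathbb Z}\beta_0(\zeta-z-2\pi nh\,e_2):\sigma_0(\zeta-z'-2\pi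 n'h\,e_2),\qquad \beta:\sigma=\operatorname{trace}(\beta^T\sigma),$$ where the double series is understood as the limit of the partial sums over $|n|\le N$, $|n'|\le N'$ as $N,N'\to\infty$. Set $$U_{\rm self}(z)=\frac1{2\pi h}\int_{\Omega_h\setminus B}q^{\rm per}_{z,z}(\zeta)\,d\zeta,\qquad U_{\rm int}(z,z')=\frac1{2\pi h}\int_{\Omega_h}q^{\rm per}_{z,z'}(\zeta)\,d\zeta,$$ where $B=\bigcup_{n\in\mathbb Z}B_\rho(z+2\pi nh\,e_2)$ is the disc of core radius $\rho=b$ about $z$, taken modulo the period $2\pi h\,e_2$ (on $\Omega_h$ it is just $B_\rho(z)$ if $B_\rho(z)\subset\Omega_h$). Let $$W_\alpha(x,y)=\frac12\left[\frac{\alpha\,x\sinh x}{\cosh x-\cos y}-\log\bigl(2(\cosh x-\cos y)\bigr)+(1-\alpha)|x|\right].$$ Then: 1. For all $h>0$ and $z,z'\in\mathbb R^2$ the double series converges at every $\zeta$ that is not on the vertical line through $z$ and not in $z'+2\pi h\mathbb Z e_2$. 2. For all $h>0$ and $z\in\Omega_h$ the integrand of $U_{\rm self}(z)$ is integrable, and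 $$U_{\rm self}(z)=\frac{\gamma_0b}{2\pi h}\bigl(\log h+\mathcal O(1)\bigr),\qquad h\gg1,$$ uniformly in $z$: there are $C$ and $h_0>0$ (depending on $b,\mu,\nu$) such that $\bigl|U_{\rm self}(z)-\frac{\gamma_0b}{2\pi h}\log h\bigr|\le\frac{\gamma_0b}{2\pi h}\,C$ for all $h\ge h_0$ and all $z\in\Omega_h$. 3. For all $h>0$ and all $z\ne z'$ in $\Omega_h$ the integrand of $U_{\rm int}(z,z')$ is integrable, and $$U_{\rm int}(z,z')=\frac{\gamma_0b}{2\pi h}\,W_1\bigl((z-z')/h\bigr).$$ -/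

import Mathlib

open Filter Topology MeasureTheory

noncomputable section

namespace EdgeDislocation

/-- The argument `arctan (x, y)` of the pair `(x, y)` measured from the positive `y`-axis, i.e. the
principal argument of `y + i x`. Its values lie in `(-π, π]` and its branch cut is
`{(0, y) : y < 0}`. -/
def cutAngle (p : ℝ × ℝ) : ℝ := Complex.arg ⟨p.2, p.1⟩

/-- The energy prefactor `γ₀ = μ b / (4 π (1 - ν))`. -/
def gamma0 (b μ ν : ℝ) : ℝ := μ * b / (4 * Real.pi * (1 - ν))

/-- First component of the displacement `u₀` of an edge dislocation at the origin with Burgers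
vector `(b, 0)`. -/
def disp1 (b ν : ℝ) (p : ℝ × ℝ) : ℝ :=
  -b / (8 * Real.pi * (1 - ν)) *
    (4 * (1 - ν) * cutAngle p - 2 * p.1 * p.2 / (p.1 ^ 2 + p.2 ^ 2))

/-- Second component of the displacement `u₀`. -/
def disp2 (b ν : ℝ) (p : ℝ × ℝ) : ℝ :=
  -b / (8 * Real.pi * (1 - ν)) *
    ((1 - 2 * ν) * Real.log (p.1 ^ 2 + p.2 ^ 2) + (p.1 ^ 2 - p.2 ^ 2) / (p.1 ^ 2 + p.2 ^ 2))

/-- The strain field `β₀ = ∇ u₀`, `(β₀)ᵢⱼ = ∂ⱼ uᵢ`: the regular part of the distributional gradient,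
given off the branch cut (a null set) by the classical partial derivatives. -/
def strain (b ν : ℝ) (p : ℝ × ℝ) : Matrix (Fin 2) (Fin 2) ℝ :=
  !![deriv (fun t => disp1 b ν (t, p.2)) p.1, deriv (fun t => disp1 b ν (p.1, t)) p.2;
     deriv (fun t => disp2 b ν (t, p.2)) p.1, deriv (fun t => disp2 b ν (p.1, t)) p.2]

/-- The stress field `σ₀` of an edge dislocation at the origin. -/
def stress (b μ ν : ℝ) (p : ℝ × ℝ) : Matrix (Fin 2) (Fin 2) ℝ :=
  (2 * gamma0 b μ ν / (p.1 ^ 2 + p.2 ^ 2) ^ 2) •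
    !![-p.2 * (3 * p.1 ^ 2 + p.2 ^ 2), p.1 * (p.1 ^ 2 - p.2 ^ 2);
       p.1 * (p.1 ^ 2 - p.2 ^ 2), p.2 * (p.1 ^ 2 - p.2 ^ 2)]

/-- The vector `2 π n h e₂`. -/
def shift (h : ℝ) (n : ℤ) : ℝ × ℝ := (0, 2 * Real.pi * n * h)

/-- Partial sum over `|n| ≤ N.1`, `|n'| ≤ N.2` of the double series
`½ ∑ₙ ∑ₙ' β₀(ζ - z - 2 π n h e₂) : σ₀(ζ - z' - 2 π n' h e₂)`, where `β : σ = trace (βᵀ σ)`. -/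
def qPartial (b μ ν h : ℝ) (z z' ζ : ℝ × ℝ) (N : ℕ × ℕ) : ℝ :=
  (1 / 2) * ∑ n ∈ Finset.Icc (-(N.1 : ℤ)) N.1, ∑ n' ∈ Finset.Icc (-(N.2 : ℤ)) N.2,
    Matrix.trace ((strain b ν (ζ - z - shift h n)).transpose *
      stress b μ ν (ζ - z' - shift h n'))

/-- The periodized pair energy density: the sum of the double series, which converges only
conditionally and is summed symmetrically in each of the two indices. -/
def qPer (b μ ν h : ℝ) (z z' ζ : ℝ × ℝ) : ℝ :=
  limUnder atTop (qPartial b μ ν h z z' ζ)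

/-- The periodicity strip `Ω_h = ℝ × [-π h, π h)`. -/
def strip (h : ℝ) : Set (ℝ × ℝ) :=
  {ζ | -(Real.pi * h) ≤ ζ.2 ∧ ζ.2 < Real.pi * h}

/-- The Euclidean disc of radius `ρ` about `z` modulo the period `2 π h e₂`, i.e. the union of the
discs of radius `ρ` about `z` and all its periodic copies. -/
def core (h ρ : ℝ) (z : ℝ × ℝ) : Set (ℝ × ℝ) :=
  {ζ | ∃ n : ℤ, (ζ - z - shift h n).1 ^ 2 + (ζ - z - shift h n).2 ^ 2 < ρ ^ 2}

/-- The self-energy of the dislocation at `z`, with core radius `ρ`. -/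
def Uself (b μ ν ρ h : ℝ) (z : ℝ × ℝ) : ℝ :=
  1 / (2 * Real.pi * h) * ∫ ζ in strip h \ core h ρ z, qPer b μ ν h z z ζ

/-- The interaction energy of the dislocations at `z` and `z'`. -/
def Uint (b μ ν h : ℝ) (z z' : ℝ × ℝ) : ℝ :=
  1 / (2 * Real.pi * h) * ∫ ζ in strip h, qPer b μ ν h z z' ζ

/-- The kernel `W_α`. -/
def W (α x y : ℝ) : ℝ :=
  (1 / 2) * (α * x * Real.sinh x / (Real.cosh x - Real.cos y)
    - Real.log (2 * (Real.cosh x - Real.cos y)) + (1 - α) * |x|)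

end EdgeDislocation

end

/-! Put g = 1 / (y - i x) at the point (x, y). Off the vertical axis, half the product β₀ : σ₀ at
two points equals γ₀ b / (2π(1 - ν)) times (1 - 2ν) Re g Re g' + x x' Re(g² conj(g'²)), see
`trace_strain_mul_stress`. A vertical shift changes neither x nor x', so the double partial sum is
built from products of single lattice sums. These are the classical expansions of π cot(πv) and π² /
sin²(πv). Hence the series converges, its sum is `periodicDensity`, and rescaling by h reduces
everything to h = 1.

For x > 0 put u = exp(-x + i y). The shear profile is Im(u / (1 - u)), and the dipole profiles are,
up to sign, the real and imaginary parts of u / (1 - u)². Integrals over a period in y are therefore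
means over the unit circle, which Cauchy's formula evaluates. With P = `periodicPressure` and c the
vertical separation, a product of shears gives π P(|x| + |x'|, c). The dipole product gives 2π
P''(|x| + |x'|, c) if x and x' have equal signs and 0 otherwise.

Let a be the horizontal separation of the pair and t the abscissa relative to the midpoint. Then |x|
+ |x'| is the constant |a| between the two dislocations and 2|t| outside, where x x' = t² - a² / 4.
The outer part has the explicit primitive `pairPrimitive`. If Q is the primitive of P that vanishes
at infinity, the total is 2π(1 - ν)(|a| P(|a|, c) - Q(|a|, c)) = 2π(1 - ν) W₁: the two contributions
carrying 1 - 2ν and 1 combine to 2(1 - ν), which cancels the prefactor.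

For the self-energy the rescaled core radius is ε = b / h. The region |x| > ε is integrated by the
same primitive with a = c = 0 and gives -2π(1 - ν) log ε + O(1). The slab |x| ≤ ε contributes O(1),
because outside the core the density is at most K / (ε² + y²). Integrability rests on the bound of
the density by K / (N N') with N = |sinh(w / 2)|, w = x + i y. -/

namespace EdgeDislocation

/-! ### Lattice sums: cotangent and inverse squared sine. -/

section LatticeSums

/-- Symmetric partial sums of the Mittag-Leffler expansion of `π cot (π v)`. -/
theorem tendsto_sum_Icc_inv_sub {v : ℂ} (hv : v ∈ Complex.integerComplement) :
    Tendsto (fun N : ℕ => ∑ n ∈ Finset.Icc (-(N : ℤ)) N, 1 / (v - n)) atTop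
      (𝓝 (Real.pi * Complex.cot (Real.pi * v))) := by
  -- The available expansion pairs the terms n and -n and leaves out n = 0, which is added back
  -- here.
  have h1 := (tendsto_logDeriv_euler_cot_sub hv).add_const (1 / v)
  rw [sub_add_cancel] at h1
  refine h1.congr fun N => ?_
  induction N with
  | zero => simp
  | succ N ih =>
    have := Finset.sum_Icc_succ_eq_add_endpoints (fun n : ℤ => 1 / (v - n)) (N := N)
    push_cast at this ⊢
    rw [Finset.sum_range_succ, this, ← ih]
    simp only [cotTerm]
    ring

/-- Termwise differentiation of the cotangent expansion, which is available on the upper half-plane.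
-/
theorem tsum_inv_add_sq_of_im_pos {v : ℂ} (hv : 0 < v.im) :
    ∑' n : ℤ, 1 / (v + n) ^ 2 = Real.pi ^ 2 / Complex.sin (Real.pi * v) ^ 2 := by
  have h1 := iteratedDerivWithin_cot_pi_mul_eq_mul_tsum_div_pow (k := 1) le_rfl (z := v) hv
  have hs : Complex.sin (Real.pi * v) ≠ 0 :=
    sin_pi_mul_ne_zero (UpperHalfPlane.coe_mem_integerComplement ⟨v, hv⟩)
  rw [iteratedDerivWithin_one, derivWithin_of_isOpen UpperHalfPlane.isOpen_upperHalfPlaneSet hv]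
    at h1
  have hd : HasDerivAt (fun x : ℂ => Real.pi * Complex.cot (Real.pi * x))
      (-(Real.pi ^ 2 / Complex.sin (Real.pi * v) ^ 2)) v := by
    have hl : HasDerivAt (fun x : ℂ => (Real.pi : ℂ) * x) Real.pi v := by
      simpa using (hasDerivAt_id v).const_mul (Real.pi : ℂ)
    have := ((hl.ccos.div hl.csin hs).const_mul (Real.pi : ℂ))
    refine this.congr_deriv ?_
    have h2 := Complex.sin_sq_add_cos_sq (Real.pi * v)
    field_simp
    linear_combination (-1 : ℂ) * h2
  rw [hd.deriv] at h1
  simp only [pow_one, Nat.factorial_one, Nat.cast_one, mul_one, one_add_one_eq_two] at h1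
  linear_combination h1

/-- Both sides are invariant under v ↦ -v together with n ↦ -n, so the lower half-plane follows from
the upper one. -/
theorem hasSum_inv_sub_sq {v : ℂ} (hv : v.im ≠ 0) :
    HasSum (fun n : ℤ => 1 / (v - n) ^ 2) (Real.pi ^ 2 / Complex.sin (Real.pi * v) ^ 2) := by
  have hs : ∀ u : ℂ, Summable fun n : ℤ => 1 / (u + n) ^ 2 := fun u => by
    have := EisensteinSeries.linear_right_summable u 1 (k := 2) le_rfl
    refine this.congr fun n => ?_
    simp [zpow_ofNat]
  have key : ∀ u : ℂ, 0 < u.im →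
      HasSum (fun n : ℤ => 1 / (u + n) ^ 2) (Real.pi ^ 2 / Complex.sin (Real.pi * u) ^ 2) :=
    fun u hu => by
      rw [← tsum_inv_add_sq_of_im_pos hu]
      exact (hs u).hasSum
  rcases lt_or_gt_of_ne hv with h | h
  · have := key (-v) (by simpa using h)
    rw [mul_neg, Complex.sin_neg, neg_sq] at this
    convert this using 3 with n
    ring
  · have := (Equiv.neg ℤ).hasSum_iff.mpr (key v h)
    convert this using 3 with n
    simp [sub_eq_add_neg]

/-- The point `(y - i x) / (2 π h)` of the plane in which the dislocation lattice becomes `ℤ`. -/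
noncomputable def latticePoint (h x y : ℝ) : ℂ := ((y : ℂ) - x * Complex.I) / (2 * Real.pi * h)

/-- This is 1 / (t - i x) = (t + i x) / (x² + t²). Its real part is a shear term and its square
holds both dipole terms. At a lattice point both sides are 0 by the convention on division by zero.
-/
theorem inv_latticePoint_sub {h : ℝ} (hh : 0 < h) (x y : ℝ) (n : ℤ) :
    1 / (latticePoint h x y - n) =
      2 * Real.pi * h * (((y - 2 * Real.pi * n * h) / (x ^ 2 + (y - 2 * Real.pi * n * h) ^ 2) : ℝ)
        + (x / (x ^ 2 + (y - 2 * Real.pi * n * h) ^ 2) : ℝ) * Complex.I) := by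
  have hpi : (Real.pi : ℂ) ≠ 0 := by exact_mod_cast Real.pi_ne_zero
  have hh' : (h : ℂ) ≠ 0 := by exact_mod_cast hh.ne'
  set t := y - 2 * Real.pi * n * h with ht
  have h1 : latticePoint h x y - n = ((t : ℂ) - x * Complex.I) / (2 * Real.pi * h) := by
    rw [latticePoint, ht]
    push_cast
    field_simp
    ring
  rw [h1, one_div_div]
  by_cases h0 : x ^ 2 + t ^ 2 = 0
  · have hx : x = 0 := by nlinarith
    have ht0 : t = 0 := by nlinarith
    simp [hx, ht0]
  · have h2 : ((t : ℂ) - x * Complex.I) * (t + x * Complex.I) = ((x ^ 2 + t ^ 2 : ℝ) : ℂ) := by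
      push_cast
      linear_combination (-(x : ℂ) ^ 2) * Complex.I_sq
    have h3 : ((x ^ 2 + t ^ 2 : ℝ) : ℂ) ≠ 0 := by exact_mod_cast h0
    have h4 : ((t : ℂ) - x * Complex.I) ≠ 0 := fun h => h3 (by rw [← h2, h, zero_mul])
    rw [div_eq_iff h4]
    push_cast at h2 h3 ⊢
    field_simp
    linear_combination -h2

theorem latticePoint_mem_integerComplement {h x y : ℝ} (hh : 0 < h)
    (hxy : ∀ n : ℤ, ¬ (x = 0 ∧ y = 2 * Real.pi * n * h)) :
    latticePoint h x y ∈ Complex.integerComplement := by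
  have hpi : (Real.pi : ℂ) ≠ 0 := by exact_mod_cast Real.pi_ne_zero
  have hh' : (h : ℂ) ≠ 0 := by exact_mod_cast hh.ne'
  rintro ⟨n, hn⟩
  refine hxy n ?_
  rw [latticePoint, eq_div_iff (mul_ne_zero (mul_ne_zero two_ne_zero hpi) hh')] at hn
  have h1 := congrArg Complex.re hn
  have h2 := congrArg Complex.im hn
  simp at h1 h2
  exact ⟨h2, by linarith⟩

theorem pi_mul_latticePoint {h : ℝ} (x y : ℝ) :
    Real.pi * latticePoint h x y =
      ((y / h / 2 : ℝ) : ℂ) + ((-(x / h / 2) : ℝ) : ℂ) * Complex.I := by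
  have hpi : (Real.pi : ℂ) ≠ 0 := by exact_mod_cast Real.pi_ne_zero
  rw [latticePoint]
  push_cast
  field_simp
  ring

/-- The normalized periodic shear profile, i.e. `-Im (coth (w / 2) / 2)` at `w = x + i y`. -/
noncomputable def periodicShear (x y : ℝ) : ℝ := Real.sin y / (2 * (Real.cosh x - Real.cos y))

/-- The real part of `-1 / (4 sinh² (w / 2))` at `w = x + i y`. -/
noncomputable def periodicDipoleRe (x y : ℝ) : ℝ :=
  (1 - Real.cosh x * Real.cos y) / (2 * (Real.cosh x - Real.cos y) ^ 2)

/-- The imaginary part of `-1 / (4 sinh² (w / 2))` at `w = x + i y`. -/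
noncomputable def periodicDipoleIm (x y : ℝ) : ℝ :=
  Real.sinh x * Real.sin y / (2 * (Real.cosh x - Real.cos y) ^ 2)

theorem sin_ofReal_add_neg_ofReal_mul_I (B A : ℝ) :
    Complex.sin (B + ((-A : ℝ) : ℂ) * Complex.I) =
      ⟨Real.sin B * Real.cosh A, -(Real.cos B * Real.sinh A)⟩ := by
  rw [Complex.sin_add_mul_I]
  apply Complex.ext <;> simp [← Complex.ofReal_sin, ← Complex.ofReal_cos,
    ← Complex.ofReal_sinh, ← Complex.ofReal_cosh]

theorem cos_ofReal_add_neg_ofReal_mul_I (B A : ℝ) :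
    Complex.cos (B + ((-A : ℝ) : ℂ) * Complex.I) =
      ⟨Real.cos B * Real.cosh A, Real.sin B * Real.sinh A⟩ := by
  rw [Complex.cos_add_mul_I]
  apply Complex.ext <;> simp [← Complex.ofReal_sin, ← Complex.ofReal_cos,
    ← Complex.ofReal_sinh, ← Complex.ofReal_cosh]

/-- The left side is |sin((y - i x) / 2)|², the denominator in both closed forms below. -/
theorem normSq_sin_half (x y : ℝ) :
    (Real.sin (y / 2) * Real.cosh (x / 2)) ^ 2 + (Real.cos (y / 2) * Real.sinh (x / 2)) ^ 2 =
      (Real.cosh x - Real.cos y) / 2 := by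
  have h1 : Real.cosh x = 2 * Real.cosh (x / 2) ^ 2 - 1 := by
    have := Real.cosh_two_mul (x / 2)
    rw [mul_div_cancel₀ x two_ne_zero] at this
    nlinarith [Real.cosh_sq (x / 2)]
  have h2 : Real.cos y = 2 * Real.cos (y / 2) ^ 2 - 1 := by
    rw [← Real.cos_two_mul, mul_div_cancel₀ y two_ne_zero]
  rw [h1, h2, mul_pow, mul_pow, Real.sin_sq]
  linear_combination (-Real.cos (y / 2) ^ 2) * Real.cosh_sq (x / 2)

theorem cot_half_re (x y : ℝ) :
    (Complex.cot (((y / 2 : ℝ) : ℂ) + ((-(x / 2) : ℝ) : ℂ) * Complex.I)).re =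
      2 * periodicShear x y := by
  have h2 : Real.sin y = 2 * Real.sin (y / 2) * Real.cos (y / 2) := by
    rw [← Real.sin_two_mul, mul_div_cancel₀ y two_ne_zero]
  rw [Complex.cot, sin_ofReal_add_neg_ofReal_mul_I, cos_ofReal_add_neg_ofReal_mul_I,
    Complex.div_re, ← add_div]
  have : Complex.normSq ⟨Real.sin (y / 2) * Real.cosh (x / 2),
      -(Real.cos (y / 2) * Real.sinh (x / 2))⟩ = (Real.cosh x - Real.cos y) / 2 := by
    rw [← normSq_sin_half, Complex.normSq_mk]
    ring
  rw [this, periodicShear, h2]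
  have h3 := Real.cosh_sq (x / 2)
  rw [div_div_eq_mul_div, ← mul_div_assoc, mul_comm 2 (Real.cosh x - Real.cos y), ← div_div]
  simp only
  rw [div_right_comm]
  congr 1
  linear_combination (2 * Real.sin (y / 2) * Real.cos (y / 2)) * h3

theorem inv_sin_half_sq (x y : ℝ) :
    1 / Complex.sin (((y / 2 : ℝ) : ℂ) + ((-(x / 2) : ℝ) : ℂ) * Complex.I) ^ 2 =
      4 * ((periodicDipoleRe x y : ℝ) + (periodicDipoleIm x y : ℝ) * Complex.I) := by
  set s : ℂ := Complex.sin (((y / 2 : ℝ) : ℂ) + ((-(x / 2) : ℝ) : ℂ) * Complex.I) with hs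
  have hs' := sin_ofReal_add_neg_ofReal_mul_I (y / 2) (x / 2)
  have hn : Complex.normSq s = (Real.cosh x - Real.cos y) / 2 := by
    rw [← normSq_sin_half, hs, hs', Complex.normSq_mk]
    ring
  have h1 : Real.cosh x = 2 * Real.cosh (x / 2) ^ 2 - 1 := by
    have := Real.cosh_two_mul (x / 2)
    rw [mul_div_cancel₀ x two_ne_zero] at this
    nlinarith [Real.cosh_sq (x / 2)]
  have h1' : Real.sinh x = 2 * Real.sinh (x / 2) * Real.cosh (x / 2) := by
    rw [← Real.sinh_two_mul, mul_div_cancel₀ x two_ne_zero]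
  have h2 : Real.cos y = 2 * Real.cos (y / 2) ^ 2 - 1 := by
    rw [← Real.cos_two_mul, mul_div_cancel₀ y two_ne_zero]
  have h2' : Real.sin y = 2 * Real.sin (y / 2) * Real.cos (y / 2) := by
    rw [← Real.sin_two_mul, mul_div_cancel₀ y two_ne_zero]
  have hc := Real.cosh_sq (x / 2)
  have hq := Real.sin_sq_add_cos_sq (y / 2)
  rw [one_div, ← inv_pow, Complex.inv_def, hn, mul_pow, hs, hs', periodicDipoleRe,
    periodicDipoleIm]
  have e1 : (starRingEnd ℂ) ⟨Real.sin (y / 2) * Real.cosh (x / 2),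
      -(Real.cos (y / 2) * Real.sinh (x / 2))⟩ ^ 2 =
      (((1 - Real.cosh x * Real.cos y) / 2 : ℝ) : ℂ) +
        ((Real.sinh x * Real.sin y / 2 : ℝ) : ℂ) * Complex.I := by
    rw [h1, h2, h1', h2']
    apply Complex.ext
    · simp only [pow_two, Complex.mul_re, Complex.conj_re, Complex.conj_im, Complex.add_re,
        Complex.ofReal_re, Complex.ofReal_im, Complex.I_re, Complex.I_im]
      linear_combination (Real.cosh (x / 2) ^ 2) * hq + Real.cos (y / 2) ^ 2 * hc
    · simp only [pow_two, Complex.mul_im, Complex.conj_re, Complex.conj_im, Complex.add_im,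
        Complex.ofReal_re, Complex.ofReal_im, Complex.I_re, Complex.I_im]
      ring
  rw [e1]
  push_cast
  field_simp
  ring

theorem tendsto_sum_shear {h : ℝ} (hh : 0 < h) {x y : ℝ}
    (hxy : ∀ n : ℤ, ¬ (x = 0 ∧ y = 2 * Real.pi * n * h)) :
    Tendsto (fun N : ℕ => ∑ n ∈ Finset.Icc (-(N : ℤ)) N,
      (y - 2 * Real.pi * n * h) / (x ^ 2 + (y - 2 * Real.pi * n * h) ^ 2)) atTop
      (𝓝 (periodicShear (x / h) (y / h) / h)) := by
  have h1 := tendsto_sum_Icc_inv_sub (latticePoint_mem_integerComplement hh hxy)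
  have h2 := ((Complex.continuous_re.tendsto _).comp h1).const_mul ((2 * Real.pi * h)⁻¹)
  rw [pi_mul_latticePoint, Complex.re_ofReal_mul, cot_half_re] at h2
  have hp := Real.pi_pos
  convert h2 using 2 with N
  · rw [Function.comp_apply, Complex.re_sum, Finset.mul_sum]
    refine Finset.sum_congr rfl fun n _ => ?_
    rw [inv_latticePoint_sub hh, show (2 * (Real.pi : ℂ) * h) = ((2 * Real.pi * h : ℝ) : ℂ) by
      push_cast; ring, Complex.re_ofReal_mul, ← mul_assoc, inv_mul_cancel₀ (by positivity), one_mul]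
    simp only [Complex.add_re, Complex.re_ofReal_mul, Complex.ofReal_re, Complex.I_re, mul_zero,
      add_zero]
  · field_simp

theorem tendsto_sum_dipole {h : ℝ} (hh : 0 < h) {x y : ℝ} (hx : x ≠ 0) :
    Tendsto (fun N : ℕ => ∑ n ∈ Finset.Icc (-(N : ℤ)) N,
      ((((y - 2 * Real.pi * n * h) / (x ^ 2 + (y - 2 * Real.pi * n * h) ^ 2) : ℝ) : ℂ)
        + (x / (x ^ 2 + (y - 2 * Real.pi * n * h) ^ 2) : ℝ) * Complex.I) ^ 2) atTop
      (𝓝 (((periodicDipoleRe (x / h) (y / h) / h ^ 2 : ℝ) : ℂ) +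
        (periodicDipoleIm (x / h) (y / h) / h ^ 2 : ℝ) * Complex.I)) := by
  have hv : (latticePoint h x y).im ≠ 0 := by
    have : (latticePoint h x y).im = -(x / (2 * Real.pi * h)) := by
      rw [latticePoint, show (2 * (Real.pi : ℂ) * h) = ((2 * Real.pi * h : ℝ) : ℂ) by
        push_cast; ring, Complex.div_ofReal_im]
      simp [neg_div]
    rw [this, neg_ne_zero]
    exact div_ne_zero hx (by positivity)
  have h1 := ((hasSum_inv_sub_sq hv).comp Finset.tendsto_Icc_neg).const_mul
    ((2 * Real.pi * h : ℂ)⁻¹ ^ 2)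
  have hpi : (Real.pi : ℂ) ≠ 0 := by exact_mod_cast Real.pi_ne_zero
  have hh' : (h : ℂ) ≠ 0 := by exact_mod_cast hh.ne'
  rw [div_eq_mul_one_div, pi_mul_latticePoint, inv_sin_half_sq] at h1
  convert h1 using 2 with N
  · rw [Function.comp_apply, Finset.mul_sum]
    refine Finset.sum_congr rfl fun n _ => ?_
    rw [← one_div_pow, inv_latticePoint_sub hh, mul_pow, ← mul_assoc, ← mul_pow,
      inv_mul_cancel₀ (mul_ne_zero (mul_ne_zero two_ne_zero hpi) hh'), one_pow, one_mul]
  · push_cast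
    field_simp
    ring

/-- The factor x stays outside the sum so that x = 0 is covered: the vertical line through z' is not
excluded from the convergence claim, and there the term vanishes. -/
theorem tendsto_mul_sum_dipoleRe {h : ℝ} (hh : 0 < h) (x y : ℝ) :
    Tendsto (fun N : ℕ => x * ∑ n ∈ Finset.Icc (-(N : ℤ)) N,
      ((y - 2 * Real.pi * n * h) ^ 2 - x ^ 2) / (x ^ 2 + (y - 2 * Real.pi * n * h) ^ 2) ^ 2) atTop
      (𝓝 (x * (periodicDipoleRe (x / h) (y / h) / h ^ 2))) := by
  rcases eq_or_ne x 0 with rfl | hx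
  · simp
  refine Tendsto.const_mul x ?_
  convert (Complex.continuous_re.tendsto _).comp (tendsto_sum_dipole hh (y := y) hx) using 2 with N
  · rw [Function.comp_apply, Complex.re_sum]
    refine Finset.sum_congr rfl fun n _ => ?_
    rw [pow_two (_ + _ * Complex.I)]
    simp only [Complex.mul_re, Complex.add_re, Complex.add_im, Complex.mul_im, Complex.ofReal_re,
      Complex.ofReal_im, Complex.I_re, Complex.I_im]
    generalize x ^ 2 + (y - 2 * Real.pi * n * h) ^ 2 = r
    ring
  · simp only [Complex.add_re, Complex.mul_re, Complex.ofReal_re, Complex.ofReal_im, Complex.I_re,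
      Complex.I_im]
    ring

theorem tendsto_mul_sum_dipoleIm {h : ℝ} (hh : 0 < h) (x y : ℝ) :
    Tendsto (fun N : ℕ => x * ∑ n ∈ Finset.Icc (-(N : ℤ)) N,
      2 * x * (y - 2 * Real.pi * n * h) / (x ^ 2 + (y - 2 * Real.pi * n * h) ^ 2) ^ 2) atTop
      (𝓝 (x * (periodicDipoleIm (x / h) (y / h) / h ^ 2))) := by
  rcases eq_or_ne x 0 with rfl | hx
  · simp
  refine Tendsto.const_mul x ?_
  convert (Complex.continuous_im.tendsto _).comp (tendsto_sum_dipole hh (y := y) hx) using 2 with N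
  · rw [Function.comp_apply, Complex.im_sum]
    refine Finset.sum_congr rfl fun n _ => ?_
    rw [pow_two (_ + _ * Complex.I)]
    simp only [Complex.mul_re, Complex.add_re, Complex.add_im, Complex.mul_im, Complex.ofReal_re,
      Complex.ofReal_im, Complex.I_re, Complex.I_im]
    generalize x ^ 2 + (y - 2 * Real.pi * n * h) ^ 2 = r
    ring
  · simp only [Complex.add_im, Complex.mul_im, Complex.ofReal_re, Complex.ofReal_im, Complex.I_re,
      Complex.I_im]
    ring

end LatticeSums

/-! ### Closed form of the periodized energy density. -/

section Density

/-- The argument is the imaginary part of the logarithm, and a nonzero imaginary part keeps the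
point off the slit. -/
theorem hasDerivAt_arg_of_im_ne_zero {f : ℝ → ℂ} {f' : ℂ} {t : ℝ} (hf : HasDerivAt f f' t)
    (h : (f t).im ≠ 0) : HasDerivAt (fun s => Complex.arg (f s)) (f' / f t).im t := by
  have := hf.clog_real (Complex.mem_slitPlane_iff.mpr (Or.inr h))
  exact (Complex.imCLM.hasFDerivAt.comp_hasDerivAt t this).congr_of_eventuallyEq
    (Eventually.of_forall fun s => (Complex.log_im _).symm)

theorem hasDerivAt_cutAngle_fst {x : ℝ} (hx : x ≠ 0) (y : ℝ) :
    HasDerivAt (fun t => cutAngle (t, y)) (y / (x ^ 2 + y ^ 2)) x := by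
  have h1 : HasDerivAt (fun t : ℝ => (⟨y, t⟩ : ℂ)) Complex.I x := by
    have : HasDerivAt (fun t : ℝ => (y : ℂ) + t * Complex.I) (1 * Complex.I) x :=
      (Complex.ofRealCLM.hasDerivAt.mul_const Complex.I).const_add _
    rw [one_mul] at this
    refine this.congr_of_eventuallyEq (Eventually.of_forall fun t => ?_)
    exact Complex.mk_eq_add_mul_I _ _
  refine (hasDerivAt_arg_of_im_ne_zero h1 hx).congr_deriv ?_
  simp [Complex.div_im, Complex.normSq_mk]
  ring

theorem hasDerivAt_cutAngle_snd {x : ℝ} (hx : x ≠ 0) (y : ℝ) :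
    HasDerivAt (fun t => cutAngle (x, t)) (-x / (x ^ 2 + y ^ 2)) y := by
  have h1 : HasDerivAt (fun t : ℝ => (⟨t, x⟩ : ℂ)) 1 y := by
    have : HasDerivAt (fun t : ℝ => (t : ℂ) + x * Complex.I) 1 y :=
      Complex.ofRealCLM.hasDerivAt.add_const _
    refine this.congr_of_eventuallyEq (Eventually.of_forall fun t => ?_)
    exact Complex.mk_eq_add_mul_I _ _
  refine (hasDerivAt_arg_of_im_ne_zero h1 hx).congr_deriv ?_
  simp [Complex.normSq_mk]
  ring

/-- The strain field off the vertical axis. -/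
theorem strain_eq (b ν : ℝ) {x : ℝ} (hx : x ≠ 0) (y : ℝ) :
    strain b ν (x, y) = (-b / (8 * Real.pi * (1 - ν))) •
      !![(2 - 4 * ν) * y / (x ^ 2 + y ^ 2) + 4 * x ^ 2 * y / (x ^ 2 + y ^ 2) ^ 2,
          -(4 * (1 - ν) * x / (x ^ 2 + y ^ 2)) - 2 * x * (x ^ 2 - y ^ 2) / (x ^ 2 + y ^ 2) ^ 2;
        (1 - 2 * ν) * (2 * x) / (x ^ 2 + y ^ 2) + 4 * x * y ^ 2 / (x ^ 2 + y ^ 2) ^ 2,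
          (1 - 2 * ν) * (2 * y) / (x ^ 2 + y ^ 2) - 4 * x ^ 2 * y / (x ^ 2 + y ^ 2) ^ 2] := by
  have hr : x ^ 2 + y ^ 2 ≠ 0 := by positivity
  have hX : HasDerivAt (fun t : ℝ => t ^ 2 + y ^ 2) (2 * x) x := by
    simpa using (hasDerivAt_pow 2 x).add_const (y ^ 2)
  have hY : HasDerivAt (fun t : ℝ => x ^ 2 + t ^ 2) (2 * y) y := by
    simpa using (hasDerivAt_pow 2 y).const_add (x ^ 2)
  have hX' : HasDerivAt (fun t : ℝ => t ^ 2 - y ^ 2) (2 * x) x := by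
    simpa using (hasDerivAt_pow 2 x).sub_const (y ^ 2)
  have hY' : HasDerivAt (fun t : ℝ => x ^ 2 - t ^ 2) (-(2 * y)) y := by
    simpa using (hasDerivAt_pow 2 y).const_sub (x ^ 2)
  have hxy : HasDerivAt (fun t : ℝ => 2 * t * y) (2 * y) x := by
    simpa using ((hasDerivAt_id x).const_mul 2).mul_const y
  have hyx : HasDerivAt (fun t : ℝ => 2 * x * t) (2 * x) y := by
    simpa using (hasDerivAt_id y).const_mul (2 * x)
  have h11 := ((((hasDerivAt_cutAngle_fst hx y).const_mul (4 * (1 - ν))).sub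
    (hxy.div hX hr)).const_mul (-b / (8 * Real.pi * (1 - ν)))).deriv
  have h12 := ((((hasDerivAt_cutAngle_snd hx y).const_mul (4 * (1 - ν))).sub
    (hyx.div hY hr)).const_mul (-b / (8 * Real.pi * (1 - ν)))).deriv
  have h21 := ((((hX.log hr).const_mul (1 - 2 * ν)).add
    (hX'.div hX hr)).const_mul (-b / (8 * Real.pi * (1 - ν)))).deriv
  have h22 := ((((hY.log hr).const_mul (1 - 2 * ν)).add
    (hY'.div hY hr)).const_mul (-b / (8 * Real.pi * (1 - ν)))).deriv
  have e11 : deriv (fun t => disp1 b ν (t, y)) x = _ := h11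
  have e12 : deriv (fun t => disp1 b ν (x, t)) y = _ := h12
  have e21 : deriv (fun t => disp2 b ν (t, y)) x = _ := h21
  have e22 : deriv (fun t => disp2 b ν (x, t)) y = _ := h22
  rw [strain]
  simp only [e11, e12, e21, e22]
  rw [Matrix.smul_of]
  simp only [Matrix.smul_cons, smul_eq_mul, Matrix.smul_empty]
  congr 1
  have k11 : 4 * (1 - ν) * (y / (x ^ 2 + y ^ 2)) -
      (2 * y * (x ^ 2 + y ^ 2) - 2 * x * y * (2 * x)) / (x ^ 2 + y ^ 2) ^ 2 =
      (2 - 4 * ν) * y / (x ^ 2 + y ^ 2) + 4 * x ^ 2 * y / (x ^ 2 + y ^ 2) ^ 2 := by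
    field_simp
    ring
  have k12 : 4 * (1 - ν) * (-x / (x ^ 2 + y ^ 2)) -
      (2 * x * (x ^ 2 + y ^ 2) - 2 * x * y * (2 * y)) / (x ^ 2 + y ^ 2) ^ 2 =
      -(4 * (1 - ν) * x / (x ^ 2 + y ^ 2)) -
        2 * x * (x ^ 2 - y ^ 2) / (x ^ 2 + y ^ 2) ^ 2 := by
    field_simp
    ring
  have k21 : (1 - 2 * ν) * (2 * x / (x ^ 2 + y ^ 2)) +
      (2 * x * (x ^ 2 + y ^ 2) - (x ^ 2 - y ^ 2) * (2 * x)) / (x ^ 2 + y ^ 2) ^ 2 =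
      (1 - 2 * ν) * (2 * x) / (x ^ 2 + y ^ 2) + 4 * x * y ^ 2 / (x ^ 2 + y ^ 2) ^ 2 := by
    field_simp
    ring
  have k22 : (1 - 2 * ν) * (2 * y / (x ^ 2 + y ^ 2)) +
      (-(2 * y) * (x ^ 2 + y ^ 2) - (x ^ 2 - y ^ 2) * (2 * y)) / (x ^ 2 + y ^ 2) ^ 2 =
      (1 - 2 * ν) * (2 * y) / (x ^ 2 + y ^ 2) - 4 * x ^ 2 * y / (x ^ 2 + y ^ 2) ^ 2 := by
    field_simp
    ring
  rw [k11, k12, k21, k22]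

/-- The product of one strain term with one stress term, in terms of the real and imaginary parts
of `1 / w` and `1 / w²`. -/
theorem trace_strain_mul_stress (b μ ν : ℝ) (hν : ν < 1) {x : ℝ} (hx : x ≠ 0) (y : ℝ)
    {x' y' : ℝ} (hp' : x' ^ 2 + y' ^ 2 ≠ 0) :
    (1 / 2) * Matrix.trace ((strain b ν (x, y)).transpose * stress b μ ν (x', y')) =
      gamma0 b μ ν * b / (2 * Real.pi * (1 - ν)) *
        ((1 - 2 * ν) * (y / (x ^ 2 + y ^ 2) * (y' / (x' ^ 2 + y' ^ 2))) +
          (x * x') * ((y ^ 2 - x ^ 2) / (x ^ 2 + y ^ 2) ^ 2 *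
              ((y' ^ 2 - x' ^ 2) / (x' ^ 2 + y' ^ 2) ^ 2) +
            2 * x * y / (x ^ 2 + y ^ 2) ^ 2 * (2 * x' * y' / (x' ^ 2 + y' ^ 2) ^ 2))) := by
  have hr : x ^ 2 + y ^ 2 ≠ 0 := by positivity
  have h1 : 1 - ν ≠ 0 := by linarith
  have hpi := Real.pi_ne_zero
  rw [strain_eq b ν hx, stress]
  simp only [Matrix.trace_fin_two, Matrix.mul_apply, Fin.sum_univ_two, Matrix.transpose_apply,
    Matrix.smul_apply, smul_eq_mul, Matrix.of_apply, Matrix.cons_val', Matrix.cons_val_zero,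
    Matrix.cons_val_one, Matrix.cons_val_fin_one]
  generalize gamma0 b μ ν = g
  field_simp
  ring

/-- The closed form of the periodized pair energy density at `h = 1`, up to the factor
`γ₀ b / (2 π (1 - ν))`. -/
noncomputable def periodicDensity (ν : ℝ) (p p' : ℝ × ℝ) : ℝ :=
  (1 - 2 * ν) * (periodicShear p.1 p.2 * periodicShear p'.1 p'.2) +
    p.1 * p'.1 * (periodicDipoleRe p.1 p.2 * periodicDipoleRe p'.1 p'.2 +
      periodicDipoleIm p.1 p.2 * periodicDipoleIm p'.1 p'.2)

/-- The shifts leave the horizontal coordinates unchanged, so each summand is a combination of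
products of a function of n and a function of n'. The rectangular partial sum therefore splits into
products of single sums, and the joint limit is a limit of products. -/
theorem qPartial_eq (b μ ν h : ℝ) (hν : ν < 1) {z z' ζ : ℝ × ℝ} (hz : ζ.1 ≠ z.1)
    (hz' : ∀ n : ℤ, ζ ≠ z' + shift h n) (N : ℕ × ℕ) :
    qPartial b μ ν h z z' ζ N = gamma0 b μ ν * b / (2 * Real.pi * (1 - ν)) *
      ((1 - 2 * ν) *
        ((∑ n ∈ Finset.Icc (-(N.1 : ℤ)) N.1, (ζ.2 - z.2 - 2 * Real.pi * n * h) /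
            ((ζ.1 - z.1) ^ 2 + (ζ.2 - z.2 - 2 * Real.pi * n * h) ^ 2)) *
          ∑ n ∈ Finset.Icc (-(N.2 : ℤ)) N.2, (ζ.2 - z'.2 - 2 * Real.pi * n * h) /
            ((ζ.1 - z'.1) ^ 2 + (ζ.2 - z'.2 - 2 * Real.pi * n * h) ^ 2)) +
        ((((ζ.1 - z.1) * ∑ n ∈ Finset.Icc (-(N.1 : ℤ)) N.1,
            ((ζ.2 - z.2 - 2 * Real.pi * n * h) ^ 2 - (ζ.1 - z.1) ^ 2) /
              ((ζ.1 - z.1) ^ 2 + (ζ.2 - z.2 - 2 * Real.pi * n * h) ^ 2) ^ 2) *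
          ((ζ.1 - z'.1) * ∑ n ∈ Finset.Icc (-(N.2 : ℤ)) N.2,
            ((ζ.2 - z'.2 - 2 * Real.pi * n * h) ^ 2 - (ζ.1 - z'.1) ^ 2) /
              ((ζ.1 - z'.1) ^ 2 + (ζ.2 - z'.2 - 2 * Real.pi * n * h) ^ 2) ^ 2)) +
         (((ζ.1 - z.1) * ∑ n ∈ Finset.Icc (-(N.1 : ℤ)) N.1,
            2 * (ζ.1 - z.1) * (ζ.2 - z.2 - 2 * Real.pi * n * h) /
              ((ζ.1 - z.1) ^ 2 + (ζ.2 - z.2 - 2 * Real.pi * n * h) ^ 2) ^ 2) *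
          ((ζ.1 - z'.1) * ∑ n ∈ Finset.Icc (-(N.2 : ℤ)) N.2,
            2 * (ζ.1 - z'.1) * (ζ.2 - z'.2 - 2 * Real.pi * n * h) /
              ((ζ.1 - z'.1) ^ 2 + (ζ.2 - z'.2 - 2 * Real.pi * n * h) ^ 2) ^ 2)))) := by
  rw [qPartial]
  have e : ∀ (w : ℝ × ℝ) (n : ℤ),
      ζ - w - shift h n = (ζ.1 - w.1, ζ.2 - w.2 - 2 * Real.pi * n * h) := fun w n => by
    ext <;> simp [shift]
  have hr : ∀ n : ℤ, (ζ.1 - z'.1) ^ 2 + (ζ.2 - z'.2 - 2 * Real.pi * n * h) ^ 2 ≠ 0 :=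
    fun n h0 => hz' n <| by
      have h1 : ζ.1 - z'.1 = 0 := by nlinarith
      have h2 : ζ.2 - z'.2 - 2 * Real.pi * n * h = 0 := by nlinarith
      ext <;> simp [shift] <;> linarith
  simp_rw [Finset.mul_sum, e]
  rw [Finset.sum_congr rfl fun n _ => Finset.sum_congr rfl fun n' _ =>
    trace_strain_mul_stress b μ ν hν (sub_ne_zero.mpr hz) _ (hr n')]
  simp_rw [← Finset.mul_sum]
  congr 1
  simp only [Finset.sum_add_distrib, ← Finset.mul_sum, ← Finset.sum_mul, mul_add]
  ring

theorem tendsto_qPartial (b μ ν : ℝ) (hν : ν < 1) {h : ℝ} (hh : 0 < h) {z z' ζ : ℝ × ℝ}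
    (hz : ζ.1 ≠ z.1) (hz' : ∀ n : ℤ, ζ ≠ z' + shift h n) :
    Tendsto (qPartial b μ ν h z z' ζ) atTop (𝓝 (gamma0 b μ ν * b / (2 * Real.pi * (1 - ν)) *
      (periodicDensity ν (h⁻¹ • (ζ - z)) (h⁻¹ • (ζ - z')) / h ^ 2))) := by
  rw [funext (qPartial_eq b μ ν h hν hz hz'), ← prod_atTop_atTop_eq]
  have c1 : ∀ n : ℤ, ¬ (ζ.1 - z.1 = 0 ∧ ζ.2 - z.2 = 2 * Real.pi * n * h) :=
    fun n hn => hz (sub_eq_zero.mp hn.1)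
  have c2 : ∀ n : ℤ, ¬ (ζ.1 - z'.1 = 0 ∧ ζ.2 - z'.2 = 2 * Real.pi * n * h) := fun n hn =>
    hz' n (by ext <;> simp [shift] <;> linarith [hn.1, hn.2])
  have := ((((tendsto_sum_shear hh c1).comp tendsto_fst).mul
    ((tendsto_sum_shear hh c2).comp tendsto_snd)).const_mul (1 - 2 * ν)).add
    ((((tendsto_mul_sum_dipoleRe hh (ζ.1 - z.1) (ζ.2 - z.2)).comp tendsto_fst).mul
      ((tendsto_mul_sum_dipoleRe hh (ζ.1 - z'.1) (ζ.2 - z'.2)).comp tendsto_snd)).add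
    (((tendsto_mul_sum_dipoleIm hh (ζ.1 - z.1) (ζ.2 - z.2)).comp tendsto_fst).mul
      ((tendsto_mul_sum_dipoleIm hh (ζ.1 - z'.1) (ζ.2 - z'.2)).comp tendsto_snd)))
  -- `Tendsto` is an inequality between filters, so the limit value is rewritten by composing with
  -- `le_of_eq`.
  refine (this.const_mul (gamma0 b μ ν * b / (2 * Real.pi * (1 - ν)))).congr' (f₁ := _) ?_ |>.trans
    (le_of_eq ?_)
  · exact Eventually.of_forall fun N => rfl
  · congr 2
    simp only [periodicDensity, Prod.smul_fst, Prod.smul_snd, Prod.fst_sub, Prod.snd_sub,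
      smul_eq_mul, inv_mul_eq_div]
    field_simp

theorem qPer_eq (b μ ν : ℝ) (hν : ν < 1) {h : ℝ} (hh : 0 < h) {z z' ζ : ℝ × ℝ}
    (hz : ζ.1 ≠ z.1) (hz' : ∀ n : ℤ, ζ ≠ z' + shift h n) :
    qPer b μ ν h z z' ζ = gamma0 b μ ν * b / (2 * Real.pi * (1 - ν)) *
      (periodicDensity ν (h⁻¹ • (ζ - z)) (h⁻¹ • (ζ - z')) / h ^ 2) :=
  (tendsto_qPartial b μ ν hν hh hz hz').limUnder_eq

end Density

/-! ### Integrals over one period as means over the unit circle. -/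

section CircleIntegrals

theorem cosh_sub_cos_pos {x : ℝ} (hx : x ≠ 0) (y : ℝ) : 0 < Real.cosh x - Real.cos y := by
  linarith [Real.one_lt_cosh.mpr hx, Real.cos_le_one y]

/-- The real part of `1 / (exp (s + i c) - 1)`. -/
noncomputable def periodicPressure (s c : ℝ) : ℝ :=
  Real.sinh s / (2 * (Real.cosh s - Real.cos c)) - 1 / 2

/-- The second derivative of `periodicPressure` in its first argument. -/
noncomputable def periodicPressureDeriv2 (s c : ℝ) : ℝ :=
  Real.sinh s * (Real.cosh s * Real.cos c + Real.cos c ^ 2 - 2) /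
    (2 * (Real.cosh s - Real.cos c) ^ 3)

theorem one_sub_ne_zero_of_norm_lt_one {a : ℂ} (ha : ‖a‖ < 1) : 1 - a ≠ 0 := fun h => by
  rw [← sub_eq_zero.mp h, norm_one] at ha
  exact lt_irrefl _ ha

theorem norm_exp_neg_add_mul_I_lt_one {s : ℝ} (hs : 0 < s) (c : ℝ) :
    ‖Complex.exp (-s + c * Complex.I)‖ < 1 := by
  rw [Complex.norm_exp]
  simpa using hs

/-- Exhibits the shear profile as the imaginary part of a function holomorphic in `exp (-s + c *
I)`, a point of the open unit disc; this is what makes Cauchy's formula applicable. -/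
theorem exp_div_one_sub_exp {s : ℝ} (hs : 0 < s) (c : ℝ) :
    Complex.exp (-s + c * Complex.I) / (1 - Complex.exp (-s + c * Complex.I)) =
      (periodicPressure s c : ℂ) + (periodicShear s c : ℂ) * Complex.I := by
  have hn : ‖Complex.exp (-s + c * Complex.I)‖ < 1 := norm_exp_neg_add_mul_I_lt_one hs c
  have h1 := one_sub_ne_zero_of_norm_lt_one hn
  have hD := (cosh_sub_cos_pos hs.ne' c).ne'
  have he : Complex.exp (-s + c * Complex.I) =
      ((Real.exp (-s) * Real.cos c : ℝ) : ℂ) +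
        ((Real.exp (-s) * Real.sin c : ℝ) : ℂ) * Complex.I := by
    rw [Complex.exp_add, Complex.exp_mul_I]
    push_cast
    ring
  rw [div_eq_iff h1, he, periodicPressure, periodicShear]
  have hsc := Real.sin_sq_add_cos_sq c
  have h3 : Real.exp (-s) = Real.cosh s - Real.sinh s := (Real.cosh_sub_sinh s).symm
  have h4 := Real.cosh_sq s
  apply Complex.ext
  · simp only [Complex.add_re, Complex.mul_re, Complex.sub_re, Complex.one_re, Complex.ofReal_re,
      Complex.ofReal_im, Complex.I_re, Complex.I_im, Complex.add_im, Complex.sub_im,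
      Complex.mul_im, Complex.one_im]
    rw [h3]
    field_simp
    linear_combination (-(Real.cosh s - Real.sinh s)) * hsc + Real.cos c * h4
  · simp only [Complex.add_re, Complex.mul_re, Complex.sub_re, Complex.one_re, Complex.ofReal_re,
      Complex.ofReal_im, Complex.I_re, Complex.I_im, Complex.add_im, Complex.sub_im,
      Complex.mul_im, Complex.one_im]
    rw [h3]
    field_simp
    linear_combination Real.sin c * h4

theorem exp_div_one_sub_exp_sq {s : ℝ} (hs : 0 < s) (c : ℝ) :
    Complex.exp (-s + c * Complex.I) / (1 - Complex.exp (-s + c * Complex.I)) ^ 2 =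
      (-periodicDipoleRe s c : ℂ) + (periodicDipoleIm s c : ℂ) * Complex.I := by
  have hn : ‖Complex.exp (-s + c * Complex.I)‖ < 1 := norm_exp_neg_add_mul_I_lt_one hs c
  have h1 := one_sub_ne_zero_of_norm_lt_one hn
  have hD := (cosh_sub_cos_pos hs.ne' c).ne'
  have key : ∀ a : ℂ, 1 - a ≠ 0 → a / (1 - a) ^ 2 = a / (1 - a) + (a / (1 - a)) ^ 2 :=
    fun a ha => by
      field_simp
      ring
  have hsc := Real.sin_sq_add_cos_sq c
  have h4 := Real.cosh_sq s
  rw [key _ h1, exp_div_one_sub_exp hs, periodicPressure, periodicShear, periodicDipoleRe,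
    periodicDipoleIm]
  apply Complex.ext
  · simp only [Complex.add_re, Complex.mul_re, Complex.neg_re, Complex.ofReal_re,
      Complex.ofReal_im, Complex.I_re, Complex.I_im, Complex.add_im, pow_two (_ + _ * Complex.I),
      Complex.mul_im]
    field_simp
    linear_combination (-1 : ℝ) * hsc - h4
  · simp only [Complex.add_re, Complex.mul_re, Complex.neg_im, Complex.ofReal_re,
      Complex.ofReal_im, Complex.I_re, Complex.I_im, Complex.add_im, pow_two (_ + _ * Complex.I),
      Complex.mul_im]
    field_simp
    ring

/-- The function u(1 + u) / (1 - u)³ is (u d/du)² applied to u / (1 - u), and u d/du is -∂/∂s for u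
= exp(-s + i c). -/
theorem exp_mul_one_add_exp_div_re {s : ℝ} (hs : 0 < s) (c : ℝ) :
    (Complex.exp (-s + c * Complex.I) * (1 + Complex.exp (-s + c * Complex.I)) /
      (1 - Complex.exp (-s + c * Complex.I)) ^ 3).re = periodicPressureDeriv2 s c := by
  have hn : ‖Complex.exp (-s + c * Complex.I)‖ < 1 := norm_exp_neg_add_mul_I_lt_one hs c
  have h1 := one_sub_ne_zero_of_norm_lt_one hn
  have hD := (cosh_sub_cos_pos hs.ne' c).ne'
  have key : ∀ a : ℂ, 1 - a ≠ 0 →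
      a * (1 + a) / (1 - a) ^ 3 = a / (1 - a) ^ 2 * (1 + 2 * (a / (1 - a))) :=
    fun a ha => by
      field_simp
      ring
  have hsc := Real.sin_sq_add_cos_sq c
  rw [key _ h1, exp_div_one_sub_exp_sq hs, exp_div_one_sub_exp hs, periodicPressure, periodicShear,
    periodicDipoleRe, periodicDipoleIm, periodicPressureDeriv2]
  rw [show (2 : ℂ) = ((2 : ℝ) : ℂ) by norm_cast]
  simp only [Complex.add_re, Complex.mul_re, Complex.neg_re, Complex.ofReal_re, Complex.one_re,
      Complex.ofReal_im, Complex.I_re, Complex.I_im, Complex.add_im, Complex.neg_im,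
      Complex.mul_im, Complex.one_im]
  field_simp
  linear_combination (-2 * Real.sinh s) * hsc

/-- The mean over the unit circle of a function holomorphic on the disc times the complex conjugate
of `q u / (1 - q u)²`. -/
theorem circleAverage_mul_conj_dipole {f : ℂ → ℂ} {U : Set ℂ} (hU : IsOpen U)
    (hc : Metric.closedBall (0 : ℂ) 1 ⊆ U) (hf : DifferentiableOn ℂ f U) {q : ℂ} (hq : ‖q‖ < 1) :
    Real.circleAverage (fun u => q * u / (u - q) ^ 2 * f u) 0 1 = q * deriv f q := by
  have h := Complex.two_pi_I_inv_smul_circleIntegral_sub_sq_inv_smul_of_differentiable hU hc hf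
    (w₀ := q) (by simpa using hq)
  rw [← h, circleIntegral, Real.circleAverage_def]
  rw [← intervalIntegral.integral_smul, smul_eq_mul, ← intervalIntegral.integral_const_mul,
    ← intervalIntegral.integral_const_mul]
  refine intervalIntegral.integral_congr fun θ _ => ?_
  have hpi : (Real.pi : ℂ) ≠ 0 := by exact_mod_cast Real.pi_ne_zero
  simp only [smul_eq_mul, Complex.real_smul, deriv_circleMap]
  push_cast
  field_simp

theorem integral_re_circleMap {F : ℂ → ℂ} (hF : ContinuousOn F (Metric.sphere 0 1)) :
    ∫ θ in -Real.pi..Real.pi, (F (circleMap 0 1 θ)).re =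
      2 * Real.pi * (Real.circleAverage F 0 1).re := by
  have hper : Function.Periodic (fun θ => (F (circleMap 0 1 θ)).re) (2 * Real.pi) := fun θ => by
    simp only [periodic_circleMap 0 1 θ]
  have h1 := hper.intervalIntegral_add_eq (-Real.pi) 0
  rw [show -Real.pi + 2 * Real.pi = Real.pi by ring, zero_add] at h1
  have hint : IntervalIntegrable (fun θ => F (circleMap 0 1 θ)) volume 0 (2 * Real.pi) := by
    have : CircleIntegrable F 0 1 := hF.circleIntegrable zero_le_one
    exact this
  have h2 := Complex.reCLM.intervalIntegral_comp_comm hint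
  simp only [Complex.reCLM_apply] at h2
  rw [h1, h2, Real.circleAverage_def, Complex.smul_re, smul_eq_mul]
  have := Real.pi_pos
  field_simp

theorem exp_mul_circleMap (X c θ : ℝ) :
    Complex.exp (-X + c * Complex.I) * circleMap 0 1 θ =
      Complex.exp (-X + ((θ + c : ℝ) : ℂ) * Complex.I) := by
  rw [circleMap_zero, Complex.ofReal_one, one_mul, ← Complex.exp_add]
  push_cast
  ring_nf

theorem conj_exp_neg_add_mul_I (X c : ℝ) :
    (starRingEnd ℂ) (Complex.exp (-X + c * Complex.I)) =
      Complex.exp (-X + ((-c : ℝ) : ℂ) * Complex.I) := by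
  rw [← Complex.exp_conj]
  simp

theorem one_sub_mul_ne_zero {p : ℂ} (hp : ‖p‖ < 1) {u : ℂ} (hu : ‖u‖ ≤ 1) : 1 - p * u ≠ 0 :=
  one_sub_ne_zero_of_norm_lt_one <| by
    rw [norm_mul]
    nlinarith [norm_nonneg p, norm_nonneg u]

theorem isOpen_one_sub_mul_ne_zero (p : ℂ) : IsOpen {u : ℂ | 1 - p * u ≠ 0} :=
  isOpen_ne_fun (by fun_prop) (by fun_prop)

theorem sub_ne_zero_of_norm_lt {q u : ℂ} (hq : ‖q‖ < 1) (hu : ‖u‖ = 1) : u - q ≠ 0 := fun h => by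
  rw [sub_eq_zero.mp h] at hu
  exact hq.ne hu

/-- On the unit circle the conjugate of u is 1 / u, which turns the antiholomorphic factor into a
Cauchy kernel with its pole at conj q, inside the disc. -/
theorem conj_mul_div_one_sub {q u : ℂ} (hq : ‖q‖ < 1) (hu : ‖u‖ = 1) :
    (starRingEnd ℂ) (q * u / (1 - q * u)) =
      u / (u - (starRingEnd ℂ) q) - 1 := by
  have hu0 : u ≠ 0 := fun h => by simp [h] at hu
  have hinv : (starRingEnd ℂ) u = u⁻¹ := (Complex.inv_eq_conj hu).symm
  have hq' : ‖(starRingEnd ℂ) q‖ < 1 := by simpa using hq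
  have h1 := sub_ne_zero_of_norm_lt hq' hu
  rw [map_div₀, map_sub, map_one, map_mul, hinv]
  have h2 : 1 - (starRingEnd ℂ) q * u⁻¹ = (u - (starRingEnd ℂ) q) / u := by field_simp
  rw [h2]
  field_simp
  ring

theorem conj_mul_div_one_sub_sq {q u : ℂ} (hq : ‖q‖ < 1) (hu : ‖u‖ = 1) :
    (starRingEnd ℂ) (q * u / (1 - q * u) ^ 2) =
      (starRingEnd ℂ) q * u / (u - (starRingEnd ℂ) q) ^ 2 := by
  have hu0 : u ≠ 0 := fun h => by simp [h] at hu
  have hinv : (starRingEnd ℂ) u = u⁻¹ := (Complex.inv_eq_conj hu).symm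
  have hq' : ‖(starRingEnd ℂ) q‖ < 1 := by simpa using hq
  have h1 := sub_ne_zero_of_norm_lt hq' hu
  rw [map_div₀, map_pow, map_sub, map_one, map_mul, hinv]
  have h2 : 1 - (starRingEnd ℂ) q * u⁻¹ = (u - (starRingEnd ℂ) q) / u := by field_simp
  rw [h2]
  field_simp

/-- From 2 Im F Im G = Re(F conj G) - Re(F G). The product F G is holomorphic and vanishes at 0, so
its mean is 0. The mean of F conj G is F(conj q) by Cauchy's formula, and p conj q = exp(-(X + X') -
i c). -/
theorem integral_periodicShear_mul_of_pos {X X' : ℝ} (hX : 0 < X) (hX' : 0 < X') (c : ℝ) :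
    ∫ y in -Real.pi..Real.pi, periodicShear X y * periodicShear X' (y + c) =
      Real.pi * periodicPressure (X + X') c := by
  set p : ℂ := Complex.exp (-X + ((0 : ℝ) : ℂ) * Complex.I) with hp
  set q : ℂ := Complex.exp (-X' + (c : ℂ) * Complex.I) with hq
  have hpn : ‖p‖ < 1 := norm_exp_neg_add_mul_I_lt_one hX 0
  have hqn : ‖q‖ < 1 := norm_exp_neg_add_mul_I_lt_one hX' c
  have hqn' : ‖(starRingEnd ℂ) q‖ < 1 := by simpa using hqn
  set f₁ : ℂ → ℂ := fun u => p * u / (1 - p * u) with hf₁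
  -- The extra first summand absorbs the constant -1 in `conj_mul_div_one_sub`; like F G it vanishes
  -- at 0.
  set f₂ : ℂ → ℂ := fun u => p * u / (1 - p * u) + p * u / (1 - p * u) * (q * u / (1 - q * u))
    with hf₂
  have hd₁ : DifferentiableOn ℂ f₁ (Metric.closedBall 0 1) := fun u hu => by
    have := one_sub_mul_ne_zero hpn (by simpa using hu : ‖u‖ ≤ 1)
    exact DifferentiableAt.differentiableWithinAt (by fun_prop (disch := assumption))
  have hd₂ : DifferentiableOn ℂ f₂ (Metric.closedBall 0 1) := fun u hu => by
    have := one_sub_mul_ne_zero hpn (by simpa using hu : ‖u‖ ≤ 1)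
    have := one_sub_mul_ne_zero hqn (by simpa using hu : ‖u‖ ≤ 1)
    exact DifferentiableAt.differentiableWithinAt (by fun_prop (disch := assumption))
  have hdc : ∀ {f : ℂ → ℂ}, DifferentiableOn ℂ f (Metric.closedBall 0 1) →
      DiffContOnCl ℂ f (Metric.ball 0 |1|) := fun h => by
    rw [abs_one]
    exact (h.mono Metric.closure_ball_subset_closedBall).diffContOnCl
  have a₁ := (hdc hd₁).circleAverage_smul_div (w := (starRingEnd ℂ) q) (by simpa using hqn)
  have a₂ := (hdc hd₂).circleAverage_smul_div (w := 0) (by simp)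
  have hs₁ : ContinuousOn (fun u => ((u - 0) / (u - (starRingEnd ℂ) q)) • f₁ u)
      (Metric.sphere 0 1) := by
    refine ContinuousOn.smul ((continuousOn_id.sub continuousOn_const).div
      (continuousOn_id.sub continuousOn_const) fun u hu => sub_ne_zero_of_norm_lt hqn' (by simpa using hu)) ?_
    exact hd₁.continuousOn.mono Metric.sphere_subset_closedBall
  have hs₂ : ContinuousOn (fun u => ((u - 0) / (u - 0)) • f₂ u) (Metric.sphere 0 1) := by
    refine ContinuousOn.smul ((continuousOn_id.sub continuousOn_const).div
      (continuousOn_id.sub continuousOn_const) fun u hu => ?_) ?_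
    · exact sub_ne_zero_of_norm_lt (by simp) (by simpa using hu)
    · exact hd₂.continuousOn.mono Metric.sphere_subset_closedBall
  have i₁ := integral_re_circleMap hs₁
  have i₂ := integral_re_circleMap hs₂
  rw [a₁] at i₁
  rw [a₂] at i₂
  have c₁ : IntervalIntegrable (fun θ => ((fun u => ((u - 0) / (u - (starRingEnd ℂ) q)) • f₁ u)
      (circleMap 0 1 θ)).re) volume (-Real.pi) Real.pi :=
    (Complex.continuous_re.comp_continuousOn (hs₁.comp (continuous_circleMap 0 1).continuousOn
      fun θ _ => by simp)).intervalIntegrable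
  have c₂ : IntervalIntegrable (fun θ => ((fun u => ((u - 0) / (u - 0)) • f₂ u)
      (circleMap 0 1 θ)).re) volume (-Real.pi) Real.pi :=
    (Complex.continuous_re.comp_continuousOn (hs₂.comp (continuous_circleMap 0 1).continuousOn
      fun θ _ => by simp)).intervalIntegrable
  have hv₁ : (f₁ ((starRingEnd ℂ) q)).re = periodicPressure (X + X') c := by
    have : p * (starRingEnd ℂ) q =
        Complex.exp (-((X + X' : ℝ) : ℂ) + ((-c : ℝ) : ℂ) * Complex.I) := by
      rw [hq, conj_exp_neg_add_mul_I, hp, ← Complex.exp_add]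
      push_cast
      ring_nf
    rw [hf₁]
    simp only [this]
    rw [exp_div_one_sub_exp (by positivity), periodicPressure, periodicPressure, Real.cos_neg]
    simp only [Complex.add_re, Complex.mul_re, Complex.ofReal_re, Complex.ofReal_im,
      Complex.I_re, Complex.I_im]
    ring
  have hv₂ : f₂ 0 = 0 := by simp [hf₂]
  rw [hv₁] at i₁
  rw [hv₂] at i₂
  have : ∀ y : ℝ, periodicShear X y * periodicShear X' (y + c) =
      (1 / 2) * (((fun u => ((u - 0) / (u - (starRingEnd ℂ) q)) • f₁ u) (circleMap 0 1 y)).re -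
        ((fun u => ((u - 0) / (u - 0)) • f₂ u) (circleMap 0 1 y)).re) := fun y => by
    set u := circleMap 0 1 y with hu
    have hun : ‖u‖ = 1 := by simp [hu]
    have hu0 : u ≠ 0 := fun h => by simp [h] at hun
    have e₁ := exp_div_one_sub_exp hX (y + 0)
    have e₂ := exp_div_one_sub_exp hX' (y + c)
    rw [← exp_mul_circleMap, ← hp, ← hu, add_zero] at e₁
    rw [← exp_mul_circleMap, ← hq, ← hu] at e₂
    have e₃ := conj_mul_div_one_sub hqn hun
    simp only [sub_zero, smul_eq_mul, div_self hu0, one_mul, hf₁, hf₂]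
    rw [sub_eq_iff_eq_add.mp e₃.symm, e₁, e₂]
    simp only [map_add, map_mul, Complex.conj_ofReal, Complex.conj_I, Complex.add_re,
      Complex.mul_re, Complex.add_im, Complex.mul_im, Complex.ofReal_re, Complex.ofReal_im,
      Complex.I_re, Complex.I_im, Complex.neg_re, Complex.neg_im, Complex.one_re, Complex.one_im]
    ring
  simp_rw [this]
  rw [intervalIntegral.integral_const_mul, intervalIntegral.integral_sub c₁ c₂, i₁, i₂]
  simp only [Complex.zero_re]
  ring

/-- The integrand is Re(F conj G). Here conj G is a kernel with a double pole at conj q, so Cauchy's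
formula for the derivative gives conj q · F'(conj q). -/
theorem integral_dipole_mul_of_pos {X X' : ℝ} (hX : 0 < X) (hX' : 0 < X') (c : ℝ) :
    ∫ y in -Real.pi..Real.pi, (periodicDipoleRe X y * periodicDipoleRe X' (y + c) +
        periodicDipoleIm X y * periodicDipoleIm X' (y + c)) =
      2 * Real.pi * periodicPressureDeriv2 (X + X') c := by
  set p : ℂ := Complex.exp (-X + ((0 : ℝ) : ℂ) * Complex.I) with hp
  set q : ℂ := Complex.exp (-X' + (c : ℂ) * Complex.I) with hq
  have hpn : ‖p‖ < 1 := norm_exp_neg_add_mul_I_lt_one hX 0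
  have hqn : ‖q‖ < 1 := norm_exp_neg_add_mul_I_lt_one hX' c
  have hqn' : ‖(starRingEnd ℂ) q‖ < 1 := by simpa using hqn
  set f : ℂ → ℂ := fun u => p * u / (1 - p * u) ^ 2 with hf
  have hsub : Metric.closedBall (0 : ℂ) 1 ⊆ {u : ℂ | 1 - p * u ≠ 0} := fun u hu =>
    one_sub_mul_ne_zero hpn (by simpa using hu)
  have hd : DifferentiableOn ℂ f {u : ℂ | 1 - p * u ≠ 0} := fun u hu => by
    have : (1 - p * u) ^ 2 ≠ 0 := pow_ne_zero 2 hu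
    exact DifferentiableAt.differentiableWithinAt (by fun_prop (disch := assumption))
  have a := circleAverage_mul_conj_dipole (isOpen_one_sub_mul_ne_zero p) hsub hd hqn'
  have hs : ContinuousOn (fun u => (starRingEnd ℂ) q * u / (u - (starRingEnd ℂ) q) ^ 2 * f u)
      (Metric.sphere 0 1) := by
    refine ContinuousOn.mul ((continuousOn_const.mul continuousOn_id).div
      ((continuousOn_id.sub continuousOn_const).pow 2) fun u hu =>
        pow_ne_zero 2 (sub_ne_zero_of_norm_lt hqn' (by simpa using hu))) ?_
    exact hd.continuousOn.mono (Metric.sphere_subset_closedBall.trans hsub)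
  have i := integral_re_circleMap hs
  rw [a] at i
  have hv : ((starRingEnd ℂ) q * deriv f ((starRingEnd ℂ) q)).re =
      periodicPressureDeriv2 (X + X') c := by
    have h1 := one_sub_mul_ne_zero hpn hqn'.le
    have hder : HasDerivAt f (p * (1 + p * (starRingEnd ℂ) q) / (1 - p * (starRingEnd ℂ) q) ^ 3)
        ((starRingEnd ℂ) q) := by
      have d1 : HasDerivAt (fun u : ℂ => p * u) p ((starRingEnd ℂ) q) := by
        simpa using (hasDerivAt_id ((starRingEnd ℂ) q)).const_mul p
      refine (d1.div ((d1.const_sub 1).pow 2) (pow_ne_zero 2 h1)).congr_deriv ?_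
      simp only [Pi.pow_apply]
      field_simp
      push_cast
      ring
    have : p * (starRingEnd ℂ) q =
        Complex.exp (-((X + X' : ℝ) : ℂ) + ((-c : ℝ) : ℂ) * Complex.I) := by
      rw [hq, conj_exp_neg_add_mul_I, hp, ← Complex.exp_add]
      push_cast
      ring_nf
    rw [hder.deriv, ← mul_div_assoc, ← mul_assoc, mul_comm _ p, this,
      exp_mul_one_add_exp_div_re (by positivity), periodicPressureDeriv2, periodicPressureDeriv2,
      Real.cos_neg]
  rw [← hv, ← i]
  refine intervalIntegral.integral_congr fun y _ => ?_
  have hun : ‖circleMap 0 1 y‖ = 1 := by simp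
  have e₁ := exp_div_one_sub_exp_sq hX (y + 0)
  have e₂ := exp_div_one_sub_exp_sq hX' (y + c)
  rw [← exp_mul_circleMap, ← hp, add_zero] at e₁
  rw [← exp_mul_circleMap, ← hq] at e₂
  simp only [hf]
  rw [← conj_mul_div_one_sub_sq hqn hun, e₁, e₂]
  simp only [map_add, map_mul, map_neg, Complex.conj_ofReal, Complex.conj_I, Complex.add_re,
    Complex.mul_re, Complex.add_im, Complex.mul_im, Complex.ofReal_re, Complex.ofReal_im,
    Complex.I_re, Complex.I_im, Complex.neg_re, Complex.neg_im]
  ring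

/-- The integrand is Re(F G) without a conjugate, and F G is holomorphic on the disc and vanishes at
0. -/
theorem integral_dipole_mul_neg_of_pos {X X' : ℝ} (hX : 0 < X) (hX' : 0 < X') (c : ℝ) :
    ∫ y in -Real.pi..Real.pi, (periodicDipoleRe X y * periodicDipoleRe X' (y + c) -
        periodicDipoleIm X y * periodicDipoleIm X' (y + c)) = 0 := by
  set p : ℂ := Complex.exp (-X + ((0 : ℝ) : ℂ) * Complex.I) with hp
  set q : ℂ := Complex.exp (-X' + (c : ℂ) * Complex.I) with hq
  have hpn : ‖p‖ < 1 := norm_exp_neg_add_mul_I_lt_one hX 0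
  have hqn : ‖q‖ < 1 := norm_exp_neg_add_mul_I_lt_one hX' c
  set f : ℂ → ℂ := fun u => p * u / (1 - p * u) ^ 2 * (q * u / (1 - q * u) ^ 2) with hf
  have hd : DifferentiableOn ℂ f (Metric.closedBall 0 1) := fun u hu => by
    have : (1 - p * u) ^ 2 ≠ 0 := pow_ne_zero 2 (one_sub_mul_ne_zero hpn (by simpa using hu))
    have : (1 - q * u) ^ 2 ≠ 0 := pow_ne_zero 2 (one_sub_mul_ne_zero hqn (by simpa using hu))
    exact DifferentiableAt.differentiableWithinAt (by fun_prop (disch := assumption))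
  have hdc : DiffContOnCl ℂ f (Metric.ball 0 |1|) := by
    rw [abs_one]
    exact (hd.mono Metric.closure_ball_subset_closedBall).diffContOnCl
  have i := integral_re_circleMap (hd.continuousOn.mono Metric.sphere_subset_closedBall)
  rw [hdc.circleAverage, show f 0 = 0 by simp [hf], Complex.zero_re, mul_zero] at i
  rw [← i]
  refine intervalIntegral.integral_congr fun y _ => ?_
  have e₁ := exp_div_one_sub_exp_sq hX (y + 0)
  have e₂ := exp_div_one_sub_exp_sq hX' (y + c)
  rw [← exp_mul_circleMap, ← hp, add_zero] at e₁
  rw [← exp_mul_circleMap, ← hq] at e₂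
  simp only [hf]
  rw [e₁, e₂]
  simp only [Complex.add_re, Complex.mul_re, Complex.add_im, Complex.mul_im, Complex.ofReal_re,
    Complex.ofReal_im, Complex.I_re, Complex.I_im, Complex.neg_re, Complex.neg_im]
  ring

theorem periodicShear_abs (x y : ℝ) : periodicShear |x| y = periodicShear x y := by
  rw [periodicShear, periodicShear, Real.cosh_abs]

theorem periodicDipoleRe_neg (x y : ℝ) : periodicDipoleRe (-x) y = periodicDipoleRe x y := by
  rw [periodicDipoleRe, periodicDipoleRe, Real.cosh_neg]

theorem periodicDipoleIm_neg (x y : ℝ) : periodicDipoleIm (-x) y = -periodicDipoleIm x y := by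
  rw [periodicDipoleIm, periodicDipoleIm, Real.cosh_neg, Real.sinh_neg]
  ring

theorem integral_periodicShear_mul {x x' : ℝ} (hx : x ≠ 0) (hx' : x' ≠ 0) (c : ℝ) :
    ∫ y in -Real.pi..Real.pi, periodicShear x y * periodicShear x' (y + c) =
      Real.pi * periodicPressure (|x| + |x'|) c := by
  rw [← integral_periodicShear_mul_of_pos (abs_pos.mpr hx) (abs_pos.mpr hx')]
  simp only [periodicShear_abs]

/-- The integral over a period of the product of two dipole fields. -/
theorem integral_dipole_mul {x x' : ℝ} (hx : x ≠ 0) (hx' : x' ≠ 0) (c : ℝ) :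
    ∫ y in -Real.pi..Real.pi, (periodicDipoleRe x y * periodicDipoleRe x' (y + c) +
        periodicDipoleIm x y * periodicDipoleIm x' (y + c)) =
      if 0 < x * x' then 2 * Real.pi * periodicPressureDeriv2 (|x| + |x'|) c else 0 := by
  -- `periodicDipoleRe` is even and `periodicDipoleIm` is odd in `x`. Equal signs thus lead to Re(F
  -- conj G), opposite signs to Re(F G).
  rcases lt_or_gt_of_ne hx with h | h <;> rcases lt_or_gt_of_ne hx' with h' | h'
  · rw [if_pos (mul_pos_of_neg_of_neg h h'),
      ← integral_dipole_mul_of_pos (abs_pos.mpr hx) (abs_pos.mpr hx')]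
    simp only [periodicDipoleRe_neg, abs_of_neg h, abs_of_neg h', periodicDipoleIm_neg,
      neg_mul_neg]
  · rw [if_neg (not_lt.mpr (mul_nonpos_of_nonpos_of_nonneg h.le h'.le)),
      ← integral_dipole_mul_neg_of_pos (abs_pos.mpr hx) (abs_pos.mpr hx') c]
    simp only [periodicDipoleRe_neg, abs_of_neg h, abs_of_pos h', periodicDipoleIm_neg, neg_mul,
      sub_neg_eq_add]
  · rw [if_neg (not_lt.mpr (mul_nonpos_of_nonneg_of_nonpos h.le h'.le)),
      ← integral_dipole_mul_neg_of_pos (abs_pos.mpr hx) (abs_pos.mpr hx') c]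
    simp only [periodicDipoleRe_neg, abs_of_pos h, abs_of_neg h', periodicDipoleIm_neg, mul_neg,
      sub_neg_eq_add]
  · rw [if_pos (mul_pos h h'),
      ← integral_dipole_mul_of_pos (abs_pos.mpr hx) (abs_pos.mpr hx')]
    simp only [abs_of_pos h, abs_of_pos h']

end CircleIntegrals

/-! ### Pointwise bounds and integrability of the density. -/

section Integrability

/-- The modulus of `sinh (w / 2)` at `w = x + i y`. -/
noncomputable def halfSinhNorm (p : ℝ × ℝ) : ℝ :=
  ‖Complex.sinh (((p.1 / 2 : ℝ) : ℂ) + ((p.2 / 2 : ℝ) : ℂ) * Complex.I)‖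

theorem continuous_halfSinhNorm : Continuous halfSinhNorm := by
  unfold halfSinhNorm
  fun_prop

theorem halfSinhNorm_nonneg (p : ℝ × ℝ) : 0 ≤ halfSinhNorm p := norm_nonneg _

theorem halfSinhNorm_sq (p : ℝ × ℝ) :
    halfSinhNorm p ^ 2 = Real.sinh (p.1 / 2) ^ 2 + Real.sin (p.2 / 2) ^ 2 := by
  have h : Complex.sinh (((p.1 / 2 : ℝ) : ℂ) + ((p.2 / 2 : ℝ) : ℂ) * Complex.I) =
      ⟨Real.sinh (p.1 / 2) * Real.cos (p.2 / 2), Real.cosh (p.1 / 2) * Real.sin (p.2 / 2)⟩ := by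
    rw [Complex.sinh_add, Complex.sinh_mul_I, Complex.cosh_mul_I]
    apply Complex.ext <;>
      simp only [← Complex.ofReal_sin, ← Complex.ofReal_cos, ← Complex.ofReal_sinh,
        ← Complex.ofReal_cosh, Complex.add_re, Complex.add_im, Complex.mul_re, Complex.mul_im,
        Complex.ofReal_re, Complex.ofReal_im, Complex.I_re, Complex.I_im] <;> ring
  rw [halfSinhNorm, h, Complex.sq_norm, Complex.normSq_mk]
  linear_combination (Real.sin (p.2 / 2) ^ 2) * Real.cosh_sq (p.1 / 2) +
    Real.sinh (p.1 / 2) ^ 2 * Real.sin_sq_add_cos_sq (p.2 / 2)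

theorem cosh_sub_cos_eq (p : ℝ × ℝ) :
    Real.cosh p.1 - Real.cos p.2 = 2 * halfSinhNorm p ^ 2 := by
  have h1 : Real.cosh p.1 = 2 * Real.sinh (p.1 / 2) ^ 2 + 1 := by
    have := Real.cosh_two_mul (p.1 / 2)
    rw [mul_div_cancel₀ p.1 two_ne_zero] at this
    nlinarith [Real.cosh_sq (p.1 / 2)]
  have h2 : Real.cos p.2 = 1 - 2 * Real.sin (p.2 / 2) ^ 2 := by
    have := Real.cos_two_mul (p.2 / 2)
    rw [mul_div_cancel₀ p.2 two_ne_zero] at this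
    nlinarith [Real.sin_sq_add_cos_sq (p.2 / 2)]
  rw [h1, h2, halfSinhNorm_sq]
  ring

theorem abs_sinh_half_le (p : ℝ × ℝ) : |Real.sinh (p.1 / 2)| ≤ halfSinhNorm p :=
  abs_le_of_sq_le_sq (by rw [halfSinhNorm_sq]; nlinarith [sq_nonneg (Real.sin (p.2 / 2))])
    (halfSinhNorm_nonneg p)

theorem abs_sin_half_le (p : ℝ × ℝ) : |Real.sin (p.2 / 2)| ≤ halfSinhNorm p :=
  abs_le_of_sq_le_sq (by rw [halfSinhNorm_sq]; nlinarith [sq_nonneg (Real.sinh (p.1 / 2))])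
    (halfSinhNorm_nonneg p)

theorem abs_le_abs_sinh (t : ℝ) : |t| ≤ |Real.sinh t| := by
  rw [Real.abs_sinh]
  exact Real.self_le_sinh_iff.mpr (abs_nonneg t)

theorem abs_fst_le (p : ℝ × ℝ) : |p.1| ≤ 2 * halfSinhNorm p := by
  have h1 := abs_le_abs_sinh (p.1 / 2)
  have h2 := abs_sinh_half_le p
  rw [abs_div, abs_two] at h1
  linarith

theorem abs_div_two_mul_sq_le {t N : ℝ} (hN : 0 ≤ N) (ht : |t| ≤ 2 * N) :
    |t| / (4 * N ^ 2) ≤ 1 / (2 * N) := by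
  rcases hN.eq_or_lt with rfl | h
  · simp
  · rw [div_le_div_iff₀ (by positivity) (by positivity)]
    nlinarith

theorem abs_periodicShear_le (p : ℝ × ℝ) :
    |periodicShear p.1 p.2| ≤ 1 / (2 * halfSinhNorm p) := by
  have h2 : |Real.sin p.2| ≤ 2 * halfSinhNorm p := by
    have : Real.sin p.2 = 2 * Real.sin (p.2 / 2) * Real.cos (p.2 / 2) := by
      rw [← Real.sin_two_mul, mul_div_cancel₀ p.2 two_ne_zero]
    rw [this, abs_mul, abs_mul, abs_two]
    have h3 := abs_sin_half_le p
    have h4 := Real.abs_cos_le_one (p.2 / 2)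
    nlinarith [abs_nonneg (Real.sin (p.2 / 2)), abs_nonneg (Real.cos (p.2 / 2))]
  rw [periodicShear, cosh_sub_cos_eq, abs_div, ← mul_assoc, show (2 : ℝ) * 2 = 4 by norm_num,
    abs_of_nonneg (by positivity : 0 ≤ 4 * halfSinhNorm p ^ 2)]
  exact abs_div_two_mul_sq_le (halfSinhNorm_nonneg p) h2

theorem dipole_sq_add_sq (p : ℝ × ℝ) :
    periodicDipoleRe p.1 p.2 ^ 2 + periodicDipoleIm p.1 p.2 ^ 2 =
      (1 / (4 * halfSinhNorm p ^ 2)) ^ 2 := by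
  have h : (4 * halfSinhNorm p ^ 2) = 2 * (Real.cosh p.1 - Real.cos p.2) := by
    rw [cosh_sub_cos_eq]
    ring
  rw [h, periodicDipoleRe, periodicDipoleIm]
  by_cases h0 : Real.cosh p.1 - Real.cos p.2 = 0
  · simp [h0]
  · field_simp
    linear_combination (Real.cosh p.1 ^ 2 - 1) * Real.sin_sq_add_cos_sq p.2 +
      (-Real.sin p.2 ^ 2) * Real.cosh_sq p.1

/-- The dipole fields are of size 1 / N², but the prefactor satisfies |x| ≤ 2N and lowers this to 1
/ N, the size of the shear profile. -/
theorem abs_periodicDensity_le (ν : ℝ) (p p' : ℝ × ℝ) :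
    |periodicDensity ν p p'| ≤
      (|1 - 2 * ν| + 1) * (1 / (2 * halfSinhNorm p) * (1 / (2 * halfSinhNorm p'))) := by
  have hN := halfSinhNorm_nonneg p
  have hN' := halfSinhNorm_nonneg p'
  have h1 : |periodicDipoleRe p.1 p.2 * periodicDipoleRe p'.1 p'.2 +
      periodicDipoleIm p.1 p.2 * periodicDipoleIm p'.1 p'.2| ≤
      1 / (4 * halfSinhNorm p ^ 2) * (1 / (4 * halfSinhNorm p' ^ 2)) := by
    refine abs_le_of_sq_le_sq ?_ (by positivity)
    rw [mul_pow, ← dipole_sq_add_sq, ← dipole_sq_add_sq]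
    -- Cauchy–Schwarz in the plane: the hint is the deficit in Lagrange's identity.
    nlinarith [sq_nonneg (periodicDipoleRe p.1 p.2 * periodicDipoleIm p'.1 p'.2 -
      periodicDipoleIm p.1 p.2 * periodicDipoleRe p'.1 p'.2)]
  have h2 := abs_div_two_mul_sq_le hN (abs_fst_le p)
  have h3 := abs_div_two_mul_sq_le hN' (abs_fst_le p')
  rw [periodicDensity]
  refine (abs_add_le _ _).trans ?_
  rw [add_mul, one_mul, abs_mul, abs_mul (p.1 * p'.1), abs_mul (periodicShear _ _), abs_mul p.1]
  refine add_le_add (mul_le_mul_of_nonneg_left (mul_le_mul (abs_periodicShear_le p)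
    (abs_periodicShear_le p') (abs_nonneg _) (by positivity)) (abs_nonneg _)) ?_
  calc |p.1| * |p'.1| * _ ≤ |p.1| * |p'.1| *
        (1 / (4 * halfSinhNorm p ^ 2) * (1 / (4 * halfSinhNorm p' ^ 2))) :=
        mul_le_mul_of_nonneg_left h1 (by positivity)
    _ = (|p.1| / (4 * halfSinhNorm p ^ 2)) * (|p'.1| / (4 * halfSinhNorm p' ^ 2)) := by ring
    _ ≤ _ := mul_le_mul h2 h3 (by positivity) (by positivity)

theorem measurable_periodicDensity (ν : ℝ) (z z' : ℝ × ℝ) :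
    Measurable fun ζ : ℝ × ℝ => periodicDensity ν (ζ - z) (ζ - z') := by
  unfold periodicDensity periodicShear periodicDipoleRe periodicDipoleIm
  have h1 := Real.measurable_cosh
  have h2 := Real.measurable_sinh
  have h3 := Real.measurable_sin
  have h4 := Real.measurable_cos
  simp only [Prod.fst_sub, Prod.snd_sub]
  fun_prop

/-- Two uses of sinh s ≥ 2 sinh²(s / 2). Degree four is chosen so that the inverse square root
decays like x⁻², which is integrable at infinity. -/
theorem pow_four_le_sinh {t : ℝ} (ht : 0 ≤ t) : t ^ 4 / 32 ≤ Real.sinh t := by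
  have key : ∀ s : ℝ, 0 ≤ s → 2 * Real.sinh (s / 2) ^ 2 ≤ Real.sinh s := fun s hs => by
    have h1 := Real.sinh_two_mul (s / 2)
    rw [mul_div_cancel₀ s two_ne_zero] at h1
    have h2 := Real.sinh_lt_cosh (s / 2)
    have h3 : 0 ≤ Real.sinh (s / 2) := Real.sinh_nonneg_iff.mpr (by positivity)
    nlinarith
  have h1 := key t ht
  have h2 := key (t / 2) (by positivity)
  have h3 : t / 2 / 2 ≤ Real.sinh (t / 2 / 2) := Real.self_le_sinh_iff.mpr (by positivity)
  have h4 : t ^ 2 / 8 ≤ Real.sinh (t / 2) := by nlinarith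
  nlinarith [sq_nonneg t]

theorem integrable_inv_sqrt_abs_sinh :
    Integrable fun x : ℝ => (√|Real.sinh (x / 2)|)⁻¹ := by
  have hm : Measurable fun x : ℝ => (√|Real.sinh (x / 2)|)⁻¹ := by
    have := Real.measurable_sinh
    fun_prop
  have h1 : IntegrableOn (fun x : ℝ => (√|Real.sinh (x / 2)|)⁻¹) (Set.Ioc 0 1) := by
    have hb : IntegrableOn (fun x : ℝ => 2 * x ^ (-(1 / 2) : ℝ)) (Set.Ioc 0 1) := by
      have := (intervalIntegral.intervalIntegrable_rpow' (a := 0) (b := 1)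
        (r := -(1 / 2)) (by norm_num)).const_mul 2
      exact (intervalIntegrable_iff_integrableOn_Ioc_of_le zero_le_one).mp this
    refine Integrable.mono' hb hm.aestronglyMeasurable ?_
    refine (ae_restrict_iff' measurableSet_Ioc).mpr (Eventually.of_forall fun x hx => ?_)
    have hx0 : 0 < x := hx.1
    have h2 := abs_le_abs_sinh (x / 2)
    rw [abs_of_pos (by positivity : 0 < x / 2)] at h2
    rw [Real.norm_of_nonneg (by positivity), Real.rpow_neg hx0.le, ← Real.sqrt_eq_rpow]
    have h3 : √x / 2 ≤ √|Real.sinh (x / 2)| := by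
      refine Real.le_sqrt_of_sq_le ?_
      rw [div_pow, Real.sq_sqrt hx0.le]
      linarith
    have h4 : 0 < √x := Real.sqrt_pos.mpr hx0
    calc _ ≤ (√x / 2)⁻¹ := inv_anti₀ (by positivity) h3
      _ = _ := by rw [inv_div, div_eq_mul_inv]
  have h2 : IntegrableOn (fun x : ℝ => (√|Real.sinh (x / 2)|)⁻¹) (Set.Ioi 1) := by
    have hb : IntegrableOn (fun x : ℝ => 32 * x ^ (-2 : ℝ)) (Set.Ioi 1) :=
      (integrableOn_Ioi_rpow_of_lt (by norm_num) one_pos).const_mul 32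
    refine Integrable.mono' hb hm.aestronglyMeasurable ?_
    refine (ae_restrict_iff' measurableSet_Ioi).mpr (Eventually.of_forall fun x hx => ?_)
    have hx0 : 0 < x := one_pos.trans hx
    have h2 := pow_four_le_sinh (by positivity : 0 ≤ x / 2)
    rw [Real.norm_of_nonneg (by positivity), Real.rpow_neg hx0.le]
    have h3 : x ^ 2 / 32 ≤ √|Real.sinh (x / 2)| := by
      refine Real.le_sqrt_of_sq_le ((le_trans ?_ h2).trans (le_abs_self _))
      have : 0 < x ^ 4 := by positivity
      ring_nf
      linarith
    calc _ ≤ (x ^ 2 / 32)⁻¹ := inv_anti₀ (by positivity) h3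
      _ = _ := by rw [inv_div, div_eq_mul_inv, Real.rpow_two]
  have h3 : IntegrableOn (fun x : ℝ => (√|Real.sinh (x / 2)|)⁻¹) (Set.Ioi 0) := by
    rw [← Set.Ioc_union_Ioi_eq_Ioi zero_le_one]
    exact h1.union h2
  have h4 : IntegrableOn (fun x : ℝ => (√|Real.sinh (x / 2)|)⁻¹) (Set.Iio 0) := by
    have := h3.comp_neg
    simpa [neg_div] using this
  rw [← integrableOn_univ, ← Set.Iic_union_Ioi (a := (0 : ℝ))]
  exact (h4.congr_set_ae Iio_ae_eq_Iic.symm).union h3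

/-- Jordan's inequality compares the function with x^(-1/2) on (0, π]; evenness and periodicity do
the rest, including the translation by `c`. -/
theorem integrableOn_inv_sqrt_abs_sin (c : ℝ) :
    IntegrableOn (fun y : ℝ => (√|Real.sin ((y - c) / 2)|)⁻¹) (Set.Ico (-Real.pi) Real.pi) := by
  have hpi := Real.pi_pos
  have hm : Measurable fun x : ℝ => (√|Real.sin (x / 2)|)⁻¹ := by
    have := Real.measurable_sin
    fun_prop
  have h1 : IntegrableOn (fun x : ℝ => (√|Real.sin (x / 2)|)⁻¹) (Set.Ioc 0 Real.pi) := by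
    have hb : IntegrableOn (fun x : ℝ => √Real.pi * x ^ (-(1 / 2) : ℝ)) (Set.Ioc 0 Real.pi) := by
      have := (intervalIntegral.intervalIntegrable_rpow' (a := 0) (b := Real.pi)
        (r := -(1 / 2)) (by norm_num)).const_mul (√Real.pi)
      exact (intervalIntegrable_iff_integrableOn_Ioc_of_le hpi.le).mp this
    refine Integrable.mono' hb hm.aestronglyMeasurable ?_
    refine (ae_restrict_iff' measurableSet_Ioc).mpr (Eventually.of_forall fun x hx => ?_)
    have hx0 : 0 < x := hx.1
    have h2 := Real.mul_abs_le_abs_sin (x := x / 2) (by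
      rw [abs_of_pos (by positivity)]
      linarith [hx.2])
    rw [abs_of_pos (by positivity : 0 < x / 2)] at h2
    rw [Real.norm_of_nonneg (by positivity), Real.rpow_neg hx0.le, ← Real.sqrt_eq_rpow]
    have h3 : √x / √Real.pi ≤ √|Real.sin (x / 2)| := by
      rw [← Real.sqrt_div hx0.le]
      refine Real.sqrt_le_sqrt ((le_of_eq ?_).trans h2)
      field_simp
    have h4 : 0 < √x := Real.sqrt_pos.mpr hx0
    have h5 : 0 < √Real.pi := Real.sqrt_pos.mpr hpi
    calc _ ≤ (√x / √Real.pi)⁻¹ := inv_anti₀ (by positivity) h3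
      _ = _ := by rw [inv_div, div_eq_mul_inv]
  have h2 : IntervalIntegrable (fun x : ℝ => (√|Real.sin (x / 2)|)⁻¹) volume 0 Real.pi :=
    (intervalIntegrable_iff_integrableOn_Ioc_of_le hpi.le).mpr h1
  have h3 : IntervalIntegrable (fun x : ℝ => (√|Real.sin (x / 2)|)⁻¹) volume (-Real.pi) 0 := by
    have := h2.comp_sub_left 0
    simp only [zero_sub, sub_self, neg_div, Real.sin_neg, abs_neg] at this
    exact this.symm
  have hper : Function.Periodic (fun x : ℝ => (√|Real.sin (x / 2)|)⁻¹) (2 * Real.pi) := fun x => by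
    simp only
    rw [show (x + 2 * Real.pi) / 2 = x / 2 + Real.pi by ring, Real.sin_add_pi, abs_neg]
  have h4 := hper.intervalIntegrable (t := -Real.pi) (by positivity)
    (by rw [show -Real.pi + 2 * Real.pi = Real.pi by ring]; exact h3.trans h2)
    (-Real.pi - c) (Real.pi - c)
  have h5 := h4.comp_sub_right c
  rw [sub_add_cancel, sub_add_cancel] at h5
  exact (intervalIntegrable_iff_integrableOn_Ico_of_le (by linarith)).mp h5

theorem strip_one : strip 1 = Set.univ ×ˢ Set.Ico (-Real.pi) Real.pi := by
  ext p
  simp [strip]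

theorem volume_restrict_strip_one : (volume : Measure (ℝ × ℝ)).restrict (strip 1) =
    (volume : Measure ℝ).prod (volume.restrict (Set.Ico (-Real.pi) Real.pi)) := by
  rw [strip_one, Measure.volume_eq_prod, ← Measure.prod_restrict, Measure.restrict_univ]

theorem ae_sin_half_ne_zero (c : ℝ) : ∀ᵐ y : ℝ, Real.sin ((y - c) / 2) ≠ 0 := by
  have hc : (Set.range fun n : ℤ => 2 * (n * Real.pi) + c).Countable := Set.countable_range _
  filter_upwards [hc.ae_notMem volume] with y hy h0
  obtain ⟨n, hn⟩ := Real.sin_eq_zero_iff.mp h0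
  exact hy ⟨n, by simp only; linarith⟩

theorem ae_ne_real (c : ℝ) : ∀ᵐ x : ℝ, x ≠ c := by
  filter_upwards [(Set.countable_singleton c).ae_notMem volume] with x hx using hx

/-- Since N² = sinh²(x / 2) + sin²(y / 2) ≥ |sinh(x / 2) sin(y / 2)|, the function 1 / N is
dominated by a product of integrable functions of x and of y. -/
theorem integrableOn_inv_halfSinhNorm (z : ℝ × ℝ) :
    IntegrableOn (fun ζ => 1 / halfSinhNorm (ζ - z)) (strip 1) := by
  have h1 := (integrable_inv_sqrt_abs_sinh.comp_sub_right z.1).mul_prod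
    (integrableOn_inv_sqrt_abs_sin z.2)
  rw [IntegrableOn, volume_restrict_strip_one]
  refine Integrable.mono' h1 ?_ ?_
  · have : Measurable fun ζ => 1 / halfSinhNorm (ζ - z) := by
      have := continuous_halfSinhNorm.measurable
      fun_prop
    exact this.aestronglyMeasurable
  · have a1 := Measure.quasiMeasurePreserving_fst (μ := (volume : Measure ℝ))
      (ν := (volume : Measure ℝ).restrict (Set.Ico (-Real.pi) Real.pi)) |>.ae (ae_ne_real z.1)
    have a2 := Measure.quasiMeasurePreserving_snd (μ := (volume : Measure ℝ))
      (ν := (volume : Measure ℝ).restrict (Set.Ico (-Real.pi) Real.pi)) |>.ae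
      (ae_restrict_of_ae (ae_sin_half_ne_zero z.2))
    filter_upwards [a1, a2] with ζ hx hy
    have hx' : Real.sinh ((ζ.1 - z.1) / 2) ≠ 0 := by
      rw [Ne, Real.sinh_eq_zero, div_eq_zero_iff, sub_eq_zero]
      simpa using hx
    have hN := halfSinhNorm_sq (ζ - z)
    rw [Prod.fst_sub, Prod.snd_sub] at hN
    rw [Real.norm_of_nonneg (by have := halfSinhNorm_nonneg (ζ - z); positivity), ← mul_inv,
      ← Real.sqrt_mul (abs_nonneg _), one_div]
    refine inv_anti₀ (Real.sqrt_pos.mpr (mul_pos (abs_pos.mpr hx') (abs_pos.mpr hy))) ?_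
    rw [Real.sqrt_le_left (halfSinhNorm_nonneg _), hN,
      ← sq_abs (Real.sinh _), ← sq_abs (Real.sin _)]
    nlinarith [sq_nonneg (|Real.sinh ((ζ.1 - z.1) / 2)| - |Real.sin ((ζ.2 - z.2) / 2)|),
      abs_nonneg (Real.sinh ((ζ.1 - z.1) / 2)), abs_nonneg (Real.sin ((ζ.2 - z.2) / 2))]

/-- By the addition formula for sinh(B - A), sinh A and sinh B cannot both be small. If both were
below δ ≤ 1, both |cosh| would be at most 2, and the norm at z - z' would be at most 4δ, half its
value for the δ chosen. -/
theorem exists_le_halfSinhNorm {z z' : ℝ × ℝ} (h : halfSinhNorm (z - z') ≠ 0) :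
    ∃ δ > 0, ∀ ζ, δ ≤ halfSinhNorm (ζ - z) ∨ δ ≤ halfSinhNorm (ζ - z') := by
  have hM : 0 < halfSinhNorm (z - z') := lt_of_le_of_ne (halfSinhNorm_nonneg _) h.symm
  refine ⟨min 1 (halfSinhNorm (z - z') / 8), by positivity, fun ζ => ?_⟩
  by_contra! hcon
  obtain ⟨h1, h2⟩ := hcon
  have h1' := h1.trans_le (min_le_left _ _)
  have h2' := h2.trans_le (min_le_left _ _)
  have h1'' := h1.trans_le (min_le_right _ _)
  have h2'' := h2.trans_le (min_le_right _ _)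
  set A : ℂ := (((ζ - z).1 / 2 : ℝ) : ℂ) + (((ζ - z).2 / 2 : ℝ) : ℂ) * Complex.I with hA
  set B : ℂ := (((ζ - z').1 / 2 : ℝ) : ℂ) + (((ζ - z').2 / 2 : ℝ) : ℂ) * Complex.I with hB
  have hBA : (((z - z').1 / 2 : ℝ) : ℂ) + (((z - z').2 / 2 : ℝ) : ℂ) * Complex.I = B - A := by
    rw [hA, hB]
    simp only [Prod.fst_sub, Prod.snd_sub]
    push_cast
    ring
  have e1 : halfSinhNorm (ζ - z) = ‖Complex.sinh A‖ := rfl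
  have e2 : halfSinhNorm (ζ - z') = ‖Complex.sinh B‖ := rfl
  have e3 : halfSinhNorm (z - z') = ‖Complex.sinh (B - A)‖ := by rw [halfSinhNorm, hBA]
  have hc : ∀ C : ℂ, ‖Complex.sinh C‖ < 1 → ‖Complex.cosh C‖ ≤ 2 := fun C hC => by
    have : ‖Complex.cosh C‖ ^ 2 ≤ ‖Complex.sinh C‖ ^ 2 + 1 := by
      rw [← norm_pow, Complex.cosh_sq, ← norm_pow]
      exact (norm_add_le _ _).trans (by rw [norm_one])
    nlinarith [norm_nonneg (Complex.sinh C), norm_nonneg (Complex.cosh C)]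
  have hs := norm_sub_le (Complex.sinh B * Complex.cosh A) (Complex.cosh B * Complex.sinh A)
  rw [← Complex.sinh_sub, norm_mul, norm_mul, ← e1, ← e2, ← e3] at hs
  have c1 := hc A (e1 ▸ h1')
  have c2 := hc B (e2 ▸ h2')
  nlinarith [halfSinhNorm_nonneg (ζ - z), halfSinhNorm_nonneg (ζ - z'),
    norm_nonneg (Complex.cosh A), norm_nonneg (Complex.cosh B)]

theorem integrableOn_periodicDensity (ν : ℝ) {z z' : ℝ × ℝ} (h : halfSinhNorm (z - z') ≠ 0) :
    IntegrableOn (fun ζ => periodicDensity ν (ζ - z) (ζ - z')) (strip 1) := by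
  obtain ⟨δ, hδ, hmax⟩ := exists_le_halfSinhNorm h
  have hb := ((integrableOn_inv_halfSinhNorm z).add (integrableOn_inv_halfSinhNorm z')).const_mul
    ((|1 - 2 * ν| + 1) * (1 / δ))
  refine Integrable.mono' hb (measurable_periodicDensity ν z z').aestronglyMeasurable
    (Eventually.of_forall fun ζ => ?_)
  rw [Real.norm_eq_abs]
  refine (abs_periodicDensity_le ν _ _).trans ?_
  rw [mul_assoc]
  refine mul_le_mul_of_nonneg_left ?_ (by positivity)
  simp only [Pi.add_apply]
  have hN := halfSinhNorm_nonneg (ζ - z)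
  have hN' := halfSinhNorm_nonneg (ζ - z')
  have hhalf : ∀ t : ℝ, 0 ≤ t → 1 / (2 * t) ≤ 1 / t := fun t ht => by
    rw [← one_div_mul_one_div]
    have : 0 ≤ 1 / t := by positivity
    linarith
  rcases hmax ζ with hm | hm
  · have : 1 / (2 * halfSinhNorm (ζ - z)) ≤ 1 / δ :=
      one_div_le_one_div_of_le hδ (by linarith)
    have h3 : 0 ≤ 1 / halfSinhNorm (ζ - z) := by positivity
    calc _ ≤ 1 / δ * (1 / halfSinhNorm (ζ - z')) :=
          mul_le_mul this (hhalf _ hN') (by positivity) (by positivity)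
      _ ≤ _ := mul_le_mul_of_nonneg_left (by linarith) (by positivity)
  · have : 1 / (2 * halfSinhNorm (ζ - z')) ≤ 1 / δ :=
      one_div_le_one_div_of_le hδ (by linarith)
    have h3 : 0 ≤ 1 / halfSinhNorm (ζ - z') := by positivity
    rw [mul_comm (1 / (2 * _))]
    calc _ ≤ 1 / δ * (1 / halfSinhNorm (ζ - z)) :=
          mul_le_mul this (hhalf _ hN) (by positivity) (by positivity)
      _ ≤ _ := mul_le_mul_of_nonneg_left (by linarith) (by positivity)

end Integrability

/-! ### Explicit primitive of the profile in the horizontal variable. -/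

section Profile

/-- The primitive of `periodicPressure` that vanishes at infinity. -/
noncomputable def periodicPotential (s c : ℝ) : ℝ :=
  Real.log (2 * (Real.cosh s - Real.cos c)) / 2 - s / 2

theorem hasDerivAt_periodicPotential {s c : ℝ} (h : 0 < Real.cosh s - Real.cos c) :
    HasDerivAt (fun t => periodicPotential t c) (periodicPressure s c) s := by
  have h1 : HasDerivAt (fun t => 2 * (Real.cosh t - Real.cos c)) (2 * Real.sinh s) s :=
    ((Real.hasDerivAt_cosh s).sub_const _).const_mul 2
  refine (((h1.log (by positivity)).div_const 2).sub ((hasDerivAt_id s).div_const 2)).congr_deriv ?_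
  rw [periodicPressure]
  field_simp

theorem hasDerivAt_periodicPressure {s c : ℝ} (h : 0 < Real.cosh s - Real.cos c) :
    HasDerivAt (fun t => periodicPressure t c) (periodicDipoleRe s c) s := by
  have h1 : HasDerivAt (fun t => 2 * (Real.cosh t - Real.cos c)) (2 * Real.sinh s) s :=
    ((Real.hasDerivAt_cosh s).sub_const _).const_mul 2
  refine (((Real.hasDerivAt_sinh s).div h1 (by positivity)).sub_const _).congr_deriv ?_
  rw [periodicDipoleRe]
  field_simp
  linear_combination 1 * Real.cosh_sq s

theorem hasDerivAt_periodicDipoleRe {s c : ℝ} (h : 0 < Real.cosh s - Real.cos c) :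
    HasDerivAt (fun t => periodicDipoleRe t c) (periodicPressureDeriv2 s c) s := by
  have h1 : HasDerivAt (fun t => Real.cosh t - Real.cos c) (Real.sinh s) s :=
    (Real.hasDerivAt_cosh s).sub_const _
  have h2 := (h1.pow 2).const_mul 2
  have h3 : HasDerivAt (fun t => 1 - Real.cosh t * Real.cos c) (-(Real.sinh s * Real.cos c)) s :=
    ((Real.hasDerivAt_cosh s).mul_const _).const_sub 1
  refine (h3.div h2 (by simp only [Pi.pow_apply]; positivity)).congr_deriv ?_
  rw [periodicPressureDeriv2]
  simp only [Pi.pow_apply]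
  field_simp
  ring

/-- Used for the limits at infinity: in terms of exp(-s) the numerator tends to 1 and all decay
becomes explicit. -/
theorem cosh_sub_cos_eq_exp (s c : ℝ) : Real.cosh s - Real.cos c =
    (1 - 2 * Real.cos c * Real.exp (-s) + Real.exp (-s) ^ 2) / (2 * Real.exp (-s)) := by
  have h := Real.exp_pos (-s)
  have h1 : Real.exp s = (Real.exp (-s))⁻¹ := by rw [Real.exp_neg, inv_inv]
  rw [Real.cosh_eq, h1]
  field_simp
  ring

theorem tendsto_exp_denominator (c : ℝ) : Tendsto
    (fun s : ℝ => 1 - 2 * Real.cos c * Real.exp (-s) + Real.exp (-s) ^ 2) atTop (𝓝 1) := by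
  have h : Tendsto (fun s : ℝ => Real.exp (-s)) atTop (𝓝 0) :=
    Real.tendsto_exp_neg_atTop_nhds_zero
  have := ((h.const_mul (2 * Real.cos c)).const_sub 1).add (h.pow 2)
  simpa using this

theorem tendsto_periodicPotential (c : ℝ) :
    Tendsto (fun s => periodicPotential s c) atTop (𝓝 0) := by
  have h := ((Real.continuousAt_log one_ne_zero).tendsto.comp (tendsto_exp_denominator c)).div_const 2
  rw [Real.log_one, zero_div] at h
  refine h.congr' ?_
  filter_upwards [eventually_gt_atTop 0] with s hs
  have hD := cosh_sub_cos_pos hs.ne' c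
  have hE := Real.exp_pos (-s)
  have e : 2 * (Real.cosh s - Real.cos c) =
      (1 - 2 * Real.cos c * Real.exp (-s) + Real.exp (-s) ^ 2) / Real.exp (-s) := by
    rw [cosh_sub_cos_eq_exp]
    field_simp
  have hpos : 1 - 2 * Real.cos c * Real.exp (-s) + Real.exp (-s) ^ 2 ≠ 0 := fun h0 => by
    rw [h0, zero_div] at e
    linarith
  rw [periodicPotential, e, Real.log_div hpos hE.ne', Real.log_exp, Function.comp_apply]
  ring

theorem tendsto_mul_periodicPressure (c : ℝ) :
    Tendsto (fun s => s * periodicPressure s c) atTop (𝓝 0) := by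
  have h1 := Real.tendsto_pow_mul_exp_neg_atTop_nhds_zero 1
  have h0 : Tendsto (fun s : ℝ => Real.exp (-s)) atTop (𝓝 0) :=
    Real.tendsto_exp_neg_atTop_nhds_zero
  have h := (h1.mul (h0.const_sub (Real.cos c))).div (tendsto_exp_denominator c) one_ne_zero
  rw [zero_mul, zero_div] at h
  refine h.congr' ?_
  filter_upwards [eventually_gt_atTop 0] with s hs
  have hD := cosh_sub_cos_pos hs.ne' c
  have hE := Real.exp_pos (-s)
  have e := cosh_sub_cos_eq_exp s c
  have hpos : 1 - 2 * Real.cos c * Real.exp (-s) + Real.exp (-s) ^ 2 ≠ 0 := fun h0 => by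
    rw [h0, zero_div] at e
    linarith
  have hP : periodicPressure s c =
      (Real.cos c - Real.exp (-s)) / (2 * (Real.cosh s - Real.cos c)) := by
    rw [periodicPressure, ← Real.cosh_sub_sinh]
    field_simp
    ring
  rw [hP, e]
  simp only [Pi.div_apply, pow_one]
  field_simp

theorem tendsto_sq_mul_periodicDipoleRe (c : ℝ) :
    Tendsto (fun s => s ^ 2 * periodicDipoleRe s c) atTop (𝓝 0) := by
  have h1 := Real.tendsto_pow_mul_exp_neg_atTop_nhds_zero 2
  have h0 : Tendsto (fun s : ℝ => Real.exp (-s)) atTop (𝓝 0) :=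
    Real.tendsto_exp_neg_atTop_nhds_zero
  have h := (h1.mul ((h0.const_mul 2).sub (((h0.pow 2).const_add 1).const_mul (Real.cos c)))).div
    ((tendsto_exp_denominator c).pow 2) (by norm_num)
  rw [zero_mul, zero_div] at h
  refine h.congr' ?_
  filter_upwards [eventually_gt_atTop 0] with s hs
  have hD := cosh_sub_cos_pos hs.ne' c
  have hE := Real.exp_pos (-s)
  have e := cosh_sub_cos_eq_exp s c
  have hpos : 1 - 2 * Real.cos c * Real.exp (-s) + Real.exp (-s) ^ 2 ≠ 0 := fun h0 => by
    rw [h0, zero_div] at e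
    linarith
  have h2 : 1 - Real.cosh s * Real.cos c = (2 * Real.exp (-s) - Real.cos c *
      (1 + Real.exp (-s) ^ 2)) / (2 * Real.exp (-s)) := by
    have h1 : Real.exp s = (Real.exp (-s))⁻¹ := by rw [Real.exp_neg, inv_inv]
    rw [Real.cosh_eq, h1]
    field_simp
  rw [periodicDipoleRe, e, h2]
  simp only [Pi.div_apply]
  field_simp

/-- The integral over a period in `y` of the energy density of a pair of dislocations at distance
`(a, c)`, as a function of the horizontal distance `τ` to their midpoint. -/
noncomputable def pairProfile (ν a c τ : ℝ) : ℝ :=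
  (1 - 2 * ν) * (Real.pi * periodicPressure (2 * τ) c) +
    (τ ^ 2 - a ^ 2 / 4) * (2 * Real.pi * periodicPressureDeriv2 (2 * τ) c)

/-- A primitive of `pairProfile`. -/
noncomputable def pairPrimitive (ν a c τ : ℝ) : ℝ :=
  (1 - 2 * ν) * (Real.pi / 2 * periodicPotential (2 * τ) c) +
    2 * Real.pi * ((τ ^ 2 - a ^ 2 / 4) / 2 * periodicDipoleRe (2 * τ) c -
      τ / 2 * periodicPressure (2 * τ) c + periodicPotential (2 * τ) c / 4)

/-- Two integrations by parts of (τ² - a² / 4) P''(2τ), each primitive in 2τ costing a factor 1/2;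
here P' is `periodicDipoleRe` and P is the derivative of `periodicPotential`. -/
theorem hasDerivAt_pairPrimitive (ν a : ℝ) {c τ : ℝ}
    (h : 0 < Real.cosh (2 * τ) - Real.cos c) :
    HasDerivAt (pairPrimitive ν a c) (pairProfile ν a c τ) τ := by
  have hl : HasDerivAt (fun t : ℝ => 2 * t) 2 τ := by simpa using (hasDerivAt_id τ).const_mul 2
  have h1 : HasDerivAt (fun t => periodicPotential (2 * t) c) (periodicPressure (2 * τ) c * 2) τ :=
    (hasDerivAt_periodicPotential h).comp τ hl
  have h2 : HasDerivAt (fun t => periodicPressure (2 * t) c) (periodicDipoleRe (2 * τ) c * 2) τ :=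
    (hasDerivAt_periodicPressure h).comp τ hl
  have h3 : HasDerivAt (fun t => periodicDipoleRe (2 * t) c)
      (periodicPressureDeriv2 (2 * τ) c * 2) τ :=
    (hasDerivAt_periodicDipoleRe h).comp τ hl
  have h4 : HasDerivAt (fun t : ℝ => (t ^ 2 - a ^ 2 / 4) / 2) (2 * τ / 2) τ := by
    simpa using ((hasDerivAt_pow 2 τ).sub_const (a ^ 2 / 4)).div_const 2
  have h5 : HasDerivAt (fun t : ℝ => t / 2) (1 / 2) τ := (hasDerivAt_id τ).div_const 2
  refine (((h1.const_mul (Real.pi / 2)).const_mul (1 - 2 * ν)).add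
    (((((h4.mul h3).sub (h5.mul h2))).add (h1.div_const 4)).const_mul
      (2 * Real.pi))).congr_deriv ?_
  rw [pairProfile]
  ring

theorem tendsto_pairPrimitive (ν a c : ℝ) : Tendsto (pairPrimitive ν a c) atTop (𝓝 0) := by
  have hl : Tendsto (fun t : ℝ => 2 * t) atTop atTop := tendsto_id.const_mul_atTop two_pos
  have h1 := (tendsto_periodicPotential c).comp hl
  have h2 := (tendsto_mul_periodicPressure c).comp hl
  have h3 := (tendsto_sq_mul_periodicDipoleRe c).comp hl
  have h4 : Tendsto (fun s => (s ^ 2)⁻¹ * (s ^ 2 * periodicDipoleRe s c)) atTop (𝓝 0) := by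
    have : Tendsto (fun s : ℝ => (s ^ 2)⁻¹) atTop (𝓝 0) :=
      (tendsto_pow_atTop two_ne_zero).inv_tendsto_atTop
    simpa using this.mul (tendsto_sq_mul_periodicDipoleRe c)
  have h5 := h4.comp hl
  have := ((h1.const_mul (Real.pi / 2)).const_mul (1 - 2 * ν)).add
    ((((h3.div_const 8).sub (h5.const_mul (a ^ 2 / 8))).sub (h2.div_const 4)).add
      (h1.div_const 4) |>.const_mul (2 * Real.pi))
  simp only [mul_zero, zero_div, sub_zero, add_zero] at this
  refine this.congr' ?_
  filter_upwards [eventually_gt_atTop 0] with s hs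
  simp only [Function.comp_apply, pairPrimitive]
  field_simp
  ring

theorem integral_Ioi_pairProfile (ν a : ℝ) {c τ₀ : ℝ} (hτ : 0 ≤ τ₀)
    (h : 0 < Real.cosh (2 * τ₀) - Real.cos c)
    (hint : IntegrableOn (pairProfile ν a c) (Set.Ioi τ₀)) :
    ∫ τ in Set.Ioi τ₀, pairProfile ν a c τ = -pairPrimitive ν a c τ₀ := by
  rw [integral_Ioi_of_hasDerivAt_of_tendsto' (fun τ hτ' => hasDerivAt_pairPrimitive ν a ?_) hint
    (tendsto_pairPrimitive ν a c), zero_sub]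
  have hle : τ₀ ≤ τ := hτ'
  have : Real.cosh (2 * τ₀) ≤ Real.cosh (2 * τ) := by
    rw [Real.cosh_le_cosh, abs_of_nonneg (by positivity), abs_of_nonneg (by linarith)]
    linarith
  linarith

end Profile

/-! ### Integral of the interaction density over the strip. -/

section StripIntegrals

/-- Fubini on the strip, for a translate of a function that is periodic in the second variable. -/
theorem integral_strip_comp_sub {g : ℝ × ℝ → ℝ} (hg : ∀ x y, g (x, y + 2 * Real.pi) = g (x, y))
    {z : ℝ × ℝ} (hint : IntegrableOn (fun ζ => g (ζ - z)) (strip 1)) :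
    Integrable (fun x => ∫ y in -Real.pi..Real.pi, g (x, y)) ∧
      ∫ ζ in strip 1, g (ζ - z) = ∫ x, ∫ y in -Real.pi..Real.pi, g (x, y) := by
  have hpi := Real.pi_pos
  rw [IntegrableOn, volume_restrict_strip_one] at hint
  have key : ∀ x, ∫ y in Set.Ico (-Real.pi) Real.pi, g ((x, y) - z) =
      ∫ y in -Real.pi..Real.pi, g (x - z.1, y) := fun x => by
    rw [integral_Ico_eq_integral_Ioc, ← intervalIntegral.integral_of_le (by linarith)]
    have h1 := intervalIntegral.integral_comp_sub_right (a := -Real.pi) (b := Real.pi)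
      (fun y => g (x - z.1, y)) z.2
    have hper : Function.Periodic (fun y => g (x - z.1, y)) (2 * Real.pi) := fun y => hg _ _
    have h2 := hper.intervalIntegral_add_eq (-Real.pi - z.2) (-Real.pi)
    rw [show -Real.pi - z.2 + 2 * Real.pi = Real.pi - z.2 by ring,
      show -Real.pi + 2 * Real.pi = Real.pi by ring] at h2
    rw [← h2, ← h1]
    rfl
  constructor
  · have := hint.integral_prod_left
    simp only [key] at this
    have := this.comp_add_right z.1
    simpa using this
  · rw [volume_restrict_strip_one, integral_prod _ hint]
    simp only [key]
    exact integral_sub_right_eq_self (fun x => ∫ y in -Real.pi..Real.pi, g (x, y)) z.1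

theorem periodicShear_add_two_pi (x y : ℝ) :
    periodicShear x (y + 2 * Real.pi) = periodicShear x y := by
  simp only [periodicShear, Real.sin_add_two_pi, Real.cos_add_two_pi]

theorem periodicDipoleRe_add_two_pi (x y : ℝ) :
    periodicDipoleRe x (y + 2 * Real.pi) = periodicDipoleRe x y := by
  simp only [periodicDipoleRe, Real.cos_add_two_pi]

theorem periodicDipoleIm_add_two_pi (x y : ℝ) :
    periodicDipoleIm x (y + 2 * Real.pi) = periodicDipoleIm x y := by
  simp only [periodicDipoleIm, Real.sin_add_two_pi, Real.cos_add_two_pi]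

theorem periodicDensity_add_two_pi (ν x y a c : ℝ) :
    periodicDensity ν (x, y + 2 * Real.pi) ((x, y + 2 * Real.pi) + (a, c)) =
      periodicDensity ν (x, y) ((x, y) + (a, c)) := by
  simp only [periodicDensity, Prod.mk_add_mk, add_right_comm y, periodicShear_add_two_pi,
    periodicDipoleRe_add_two_pi, periodicDipoleIm_add_two_pi]

theorem continuous_periodicShear {x : ℝ} (hx : x ≠ 0) : Continuous (periodicShear x) := by
  unfold periodicShear
  exact Real.continuous_sin.div (by fun_prop) fun y =>
    mul_ne_zero two_ne_zero (cosh_sub_cos_pos hx y).ne'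

theorem continuous_periodicDipoleRe {x : ℝ} (hx : x ≠ 0) : Continuous (periodicDipoleRe x) := by
  unfold periodicDipoleRe
  exact Continuous.div (by fun_prop) (by fun_prop) fun y =>
    mul_ne_zero two_ne_zero (pow_ne_zero 2 (cosh_sub_cos_pos hx y).ne')

theorem continuous_periodicDipoleIm {x : ℝ} (hx : x ≠ 0) : Continuous (periodicDipoleIm x) := by
  unfold periodicDipoleIm
  exact Continuous.div (by fun_prop) (by fun_prop) fun y =>
    mul_ne_zero two_ne_zero (pow_ne_zero 2 (cosh_sub_cos_pos hx y).ne')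

theorem integral_periodicDensity (ν : ℝ) {x a : ℝ} (hx : x ≠ 0) (hxa : x + a ≠ 0) (c : ℝ) :
    ∫ y in -Real.pi..Real.pi, periodicDensity ν (x, y) ((x, y) + (a, c)) =
      (1 - 2 * ν) * (Real.pi * periodicPressure (|x| + |x + a|) c) + x * (x + a) *
        if 0 < x * (x + a) then 2 * Real.pi * periodicPressureDeriv2 (|x| + |x + a|) c else 0 := by
  rw [← integral_periodicShear_mul hx hxa, ← integral_dipole_mul hx hxa,
    ← intervalIntegral.integral_const_mul, ← intervalIntegral.integral_const_mul,
    ← intervalIntegral.integral_add]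
  · rfl
  · have h1 := continuous_periodicShear hx
    have h2 := continuous_periodicShear hxa
    exact Continuous.intervalIntegrable (by fun_prop) _ _
  · have h1 := continuous_periodicDipoleRe hx
    have h2 := continuous_periodicDipoleRe hxa
    have h3 := continuous_periodicDipoleIm hx
    have h4 := continuous_periodicDipoleIm hxa
    exact Continuous.intervalIntegrable (by fun_prop) _ _

/-- The integral over a period in `y` at horizontal distance `t` from the midpoint of the pair. -/
theorem integral_periodicDensity_midpoint (ν : ℝ) {t a : ℝ} (h1 : t - a / 2 ≠ 0)
    (h2 : t + a / 2 ≠ 0) (c : ℝ) :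
    ∫ y in -Real.pi..Real.pi, periodicDensity ν (t - a / 2, y) ((t - a / 2, y) + (a, c)) =
      if |a| / 2 < |t| then pairProfile ν a c |t|
      else (1 - 2 * ν) * (Real.pi * periodicPressure |a| c) := by
  have e : t - a / 2 + a = t + a / 2 := by ring
  rw [integral_periodicDensity ν h1 (by rwa [e]), e]
  -- Hence the two horizontal coordinates have equal signs exactly when |t| > |a| / 2.
  have hprod : (t - a / 2) * (t + a / 2) = |t| ^ 2 - (|a| / 2) ^ 2 := by
    rw [div_pow, sq_abs, sq_abs]
    ring
  have hta : 0 ≤ |a| / 2 := by positivity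
  split_ifs with h3 h4 h4
  · have hs : |t - a / 2| + |t + a / 2| = 2 * |t| := by
      rcases abs_cases t with ⟨ht, _⟩ | ⟨ht, _⟩ <;> rw [ht] at h4 ⊢ <;>
        rcases abs_cases a with ⟨ha, _⟩ | ⟨ha, _⟩ <;> rw [ha] at h4 <;>
        first
        | rw [abs_of_pos (by linarith), abs_of_pos (by linarith)]; ring
        | rw [abs_of_neg (by linarith), abs_of_neg (by linarith)]; ring
    rw [pairProfile, hs, hprod, div_pow, sq_abs a]
    norm_num
  · rw [hprod] at h3
    nlinarith [abs_nonneg t]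
  · rw [hprod] at h3
    nlinarith [abs_nonneg t]
  · have hs : |t - a / 2| + |t + a / 2| = |a| := by
      have h5 := abs_le.mp (not_lt.mp h4)
      rcases abs_cases a with ⟨ha, _⟩ | ⟨ha, _⟩ <;> rw [ha] at h5 ⊢
      · rw [abs_of_nonpos (by linarith), abs_of_nonneg (by linarith)]
        ring
      · rw [abs_of_nonneg (by linarith), abs_of_nonpos (by linarith)]
        ring
    rw [hs, mul_zero, add_zero]

/-- The integral of the interaction density over the strip of height `2 π`. -/
theorem setIntegral_periodicDensity (ν : ℝ) {z z' : ℝ × ℝ} (h : halfSinhNorm (z - z') ≠ 0) :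
    ∫ ζ in strip 1, periodicDensity ν (ζ - z) (ζ - z') =
      2 * Real.pi * (1 - ν) * W 1 (z.1 - z'.1) (z.2 - z'.2) := by
  have hD : 0 < Real.cosh |z.1 - z'.1| - Real.cos (z.2 - z'.2) := by
    have := cosh_sub_cos_eq (z - z')
    rw [Prod.fst_sub, Prod.snd_sub] at this
    rw [Real.cosh_abs, this]
    positivity
  have hint := integrableOn_periodicDensity ν h
  set a := z.1 - z'.1 with ha
  set c := z.2 - z'.2 with hc
  have hz : ∀ ζ : ℝ × ℝ, ζ - z' = ζ - z + (a, c) := fun ζ => by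
    ext <;> simp [ha, hc]
  simp only [hz] at hint ⊢
  obtain ⟨hi, he⟩ := integral_strip_comp_sub
    (g := fun p => periodicDensity ν p (p + (a, c)))
    (fun x y => periodicDensity_add_two_pi ν x y a c) hint
  rw [he]
  set T : ℝ → ℝ := fun x => ∫ y in -Real.pi..Real.pi, periodicDensity ν (x, y) ((x, y) + (a, c))
    with hT
  set f : ℝ → ℝ := fun τ => if |a| / 2 < τ then pairProfile ν a c τ
    else (1 - 2 * ν) * (Real.pi * periodicPressure |a| c) with hf
  -- Moving the origin to the midpoint makes the profile an even function of t, up to the two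
  -- abscissae of the dislocations.
  have hae : (fun t => T (t - a / 2)) =ᵐ[volume] fun t => f |t| := by
    filter_upwards [ae_ne_real (a / 2), ae_ne_real (-(a / 2))] with t h1 h2
    exact integral_periodicDensity_midpoint ν (sub_ne_zero.mpr h1)
      (fun h0 => h2 (by linarith)) c
  have hfi : Integrable fun t => f |t| := (hi.comp_sub_right (a / 2)).congr hae
  have h0 : (0 : ℝ) ≤ |a| / 2 := by positivity
  have hfi' : IntegrableOn f (Set.Ioi 0) :=
    hfi.integrableOn.congr_fun (fun t ht => by simp only [abs_of_pos (Set.mem_Ioi.mp ht)])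
      measurableSet_Ioi
  have hpi : IntegrableOn (pairProfile ν a c) (Set.Ioi (|a| / 2)) :=
    (hfi'.mono_set (Set.Ioi_subset_Ioi h0)).congr_fun
      (fun t ht => if_pos (Set.mem_Ioi.mp ht)) measurableSet_Ioi
  calc ∫ x, T x = ∫ t, T (t - a / 2) := (integral_sub_right_eq_self T (a / 2)).symm
    _ = ∫ t, f |t| := integral_congr_ae hae
    _ = 2 * ∫ τ in Set.Ioi 0, f τ := integral_comp_abs
    _ = 2 * ((∫ τ in Set.Ioc 0 (|a| / 2), f τ) + ∫ τ in Set.Ioi (|a| / 2), f τ) := by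
      rw [← setIntegral_union Set.Ioc_disjoint_Ioi_same measurableSet_Ioi
        (hfi'.mono_set Set.Ioc_subset_Ioi_self) (hfi'.mono_set (Set.Ioi_subset_Ioi h0)),
        Set.Ioc_union_Ioi_eq_Ioi h0]
    _ = 2 * (|a| / 2 * ((1 - 2 * ν) * (Real.pi * periodicPressure |a| c)) -
        pairPrimitive ν a c (|a| / 2)) := by
      rw [setIntegral_congr_fun (g := fun _ => (1 - 2 * ν) * (Real.pi * periodicPressure |a| c))
        measurableSet_Ioc fun t ht => if_neg (not_lt.mpr ht.2),
        setIntegral_congr_fun (g := pairProfile ν a c) measurableSet_Ioi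
        fun t ht => if_pos (Set.mem_Ioi.mp ht),
        integral_Ioi_pairProfile ν a h0 (by rwa [mul_div_cancel₀ |a| two_ne_zero]) hpi]
      simp [h0]
      ring
    -- At τ = |a| / 2 the factor τ² - a² / 4 vanishes and the dipole term drops out. What remains is
    -- 2π(1 - ν)(|a| P - Q), where the linear terms ±|a| / 2 cancel.
    _ = _ := by
      have hs : |a| * Real.sinh |a| = a * Real.sinh a := by
        rw [← Real.abs_sinh, ← abs_mul, abs_of_nonneg]
        rcases le_total 0 a with h | h
        · exact mul_nonneg h (Real.sinh_nonneg_iff.mpr h)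
        · exact mul_nonneg_of_nonpos_of_nonpos h (Real.sinh_nonpos_iff.mpr h)
      rw [pairPrimitive, mul_div_cancel₀ |a| two_ne_zero, periodicPotential, periodicPressure, W,
        div_pow, sq_abs, one_mul, ← hs, Real.cosh_abs]
      rw [Real.cosh_abs] at hD
      field_simp
      ring

end StripIntegrals

/-! ### Self-energy: excised cores and the logarithm. -/

section SelfEnergy

theorem mem_core_iff {h ρ : ℝ} {z ζ : ℝ × ℝ} : ζ ∈ core h ρ z ↔ ζ - z ∈ core h ρ 0 := by
  simp [core]

theorem measurableSet_core (h ρ : ℝ) (z : ℝ × ℝ) : MeasurableSet (core h ρ z) := by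
  have : core h ρ z = ⋃ n : ℤ, {ζ : ℝ × ℝ |
      (ζ - z - shift h n).1 ^ 2 + (ζ - z - shift h n).2 ^ 2 < ρ ^ 2} := by
    ext ζ
    simp [core]
  rw [this]
  refine MeasurableSet.iUnion fun n => (isOpen_lt ?_ continuous_const).measurableSet
  fun_prop

theorem sq_add_sq_le_halfSinhNorm_sq {p : ℝ × ℝ} (hp : |p.2| ≤ Real.pi) :
    (p.1 ^ 2 + p.2 ^ 2) / Real.pi ^ 2 ≤ halfSinhNorm p ^ 2 := by
  have hpi := Real.pi_gt_three
  have h1 := abs_le_abs_sinh (p.1 / 2)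
  have h2 := Real.mul_abs_le_abs_sin (x := p.2 / 2) (by
    rw [abs_div, abs_two]
    linarith)
  rw [halfSinhNorm_sq, add_div]
  refine add_le_add ?_ ?_
  · calc p.1 ^ 2 / Real.pi ^ 2 ≤ p.1 ^ 2 / 2 ^ 2 := by gcongr; linarith
      _ = |p.1 / 2| ^ 2 := by rw [sq_abs, div_pow]
      _ ≤ |Real.sinh (p.1 / 2)| ^ 2 := by gcongr
      _ = _ := sq_abs _
  · calc p.2 ^ 2 / Real.pi ^ 2 = (2 / Real.pi * |p.2 / 2|) ^ 2 := by
          rw [mul_pow, sq_abs]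
          field_simp
      _ ≤ |Real.sin (p.2 / 2)| ^ 2 := by gcongr
      _ = _ := sq_abs _

theorem halfSinhNorm_sub_shift (p : ℝ × ℝ) (n : ℤ) :
    halfSinhNorm (p - shift 1 n) = halfSinhNorm p := by
  rw [← sq_eq_sq₀ (halfSinhNorm_nonneg _) (halfSinhNorm_nonneg _), halfSinhNorm_sq,
    halfSinhNorm_sq]
  simp only [Prod.fst_sub, Prod.snd_sub, shift, sub_zero, mul_one]
  rw [show (p.2 - 2 * Real.pi * n) / 2 = p.2 / 2 - n * Real.pi by ring, Real.sin_sub_int_mul_pi]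
  rw [mul_pow]
  have : (((-1 : ℝ) ^ n) ^ 2) = 1 := by
    rw [← zpow_natCast, ← zpow_mul, mul_comm, zpow_mul]
    simp
  rw [this, one_mul]

/-- Subtracting the nearest period, via `round`, brings |y| below π, where N ≥ r / π; outside every
core r ≥ ε. -/
theorem le_halfSinhNorm_of_notMem_core {ε : ℝ} {p : ℝ × ℝ} (hp : p ∉ core 1 ε 0) :
    ε / Real.pi ≤ halfSinhNorm p := by
  have hpi := Real.pi_pos
  set n : ℤ := round (p.2 / (2 * Real.pi)) with hn
  have h1 := abs_sub_round (p.2 / (2 * Real.pi))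
  rw [← hn] at h1
  have h2 : |(p - shift 1 n).2| ≤ Real.pi := by
    have e : (p - shift 1 n).2 = (p.2 / (2 * Real.pi) - n) * (2 * Real.pi) := by
      simp only [Prod.snd_sub, shift]
      field_simp
    rw [e, abs_mul, abs_of_pos (by positivity : 0 < 2 * Real.pi)]
    nlinarith
  have h3 := sq_add_sq_le_halfSinhNorm_sq h2
  rw [halfSinhNorm_sub_shift] at h3
  have h4 : ε ^ 2 ≤ (p - shift 1 n).1 ^ 2 + (p - shift 1 n).2 ^ 2 := by
    by_contra! h
    exact hp ⟨n, by simpa using h⟩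
  refine le_of_sq_le_sq ?_ (halfSinhNorm_nonneg p)
  rw [div_pow]
  refine le_trans ?_ h3
  gcongr

theorem integrableOn_periodicDensity_self (ν : ℝ) (z : ℝ × ℝ) {ε : ℝ} (hε : 0 < ε) :
    IntegrableOn (fun ζ => periodicDensity ν (ζ - z) (ζ - z)) (strip 1 \ core 1 ε z) := by
  have hpi := Real.pi_pos
  have hb := ((integrableOn_inv_halfSinhNorm z).mono_set
    (Set.sdiff_subset (t := core 1 ε z))).const_mul ((|1 - 2 * ν| + 1) * (Real.pi / ε))
  have hms : MeasurableSet (strip 1) := by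
    rw [strip_one]
    exact MeasurableSet.univ.prod measurableSet_Ico
  refine Integrable.mono' hb (measurable_periodicDensity ν z z).aestronglyMeasurable ?_
  refine (ae_restrict_iff' (hms.diff (measurableSet_core 1 ε z))).mpr
    (Eventually.of_forall fun ζ hζ => ?_)
  have h1 := le_halfSinhNorm_of_notMem_core (fun h => hζ.2 (mem_core_iff.mpr h))
  have h2 : 0 < halfSinhNorm (ζ - z) := lt_of_lt_of_le (by positivity) h1
  rw [Real.norm_eq_abs]
  refine (abs_periodicDensity_le ν _ _).trans ?_
  rw [mul_assoc]
  refine mul_le_mul_of_nonneg_left ?_ (by positivity)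
  have h3 : 1 / (2 * halfSinhNorm (ζ - z)) ≤ Real.pi / ε := by
    rw [div_le_div_iff₀ (by positivity) hε]
    rw [div_le_iff₀ hpi] at h1
    nlinarith
  exact mul_le_mul h3 (one_div_le_one_div_of_le h2 (by linarith)) (by positivity) (by positivity)

/-- The self density, set to zero on the cores. -/
noncomputable def truncatedDensity (ν ε : ℝ) : ℝ × ℝ → ℝ :=
  (core 1 ε 0)ᶜ.indicator fun p => periodicDensity ν p p

theorem truncatedDensity_add_two_pi (ν ε x y : ℝ) :
    truncatedDensity ν ε (x, y + 2 * Real.pi) = truncatedDensity ν ε (x, y) := by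
  have hmem : (x, y + 2 * Real.pi) ∈ core 1 ε 0 ↔ (x, y) ∈ core 1 ε 0 := by
    constructor
    · rintro ⟨n, hn⟩
      refine ⟨n - 1, lt_of_eq_of_lt ?_ hn⟩
      simp only [shift, Prod.fst_sub, Prod.snd_sub, Prod.fst_zero, Prod.snd_zero]
      push_cast
      ring
    · rintro ⟨n, hn⟩
      refine ⟨n + 1, lt_of_eq_of_lt ?_ hn⟩
      simp only [shift, Prod.fst_sub, Prod.snd_sub, Prod.fst_zero, Prod.snd_zero]
      push_cast
      ring
  have hd := periodicDensity_add_two_pi ν x y 0 0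
  rw [Prod.mk_zero_zero, add_zero, add_zero] at hd
  by_cases h : (x, y) ∈ core 1 ε 0
  · rw [truncatedDensity, Set.indicator_of_notMem (by simpa using hmem.mpr h),
      Set.indicator_of_notMem (by simpa using h)]
  · rw [truncatedDensity, Set.indicator_of_mem (by simpa using fun h' => h (hmem.mp h')),
      Set.indicator_of_mem (by simpa using h), hd]

theorem integral_truncatedDensity (ν : ℝ) (z : ℝ × ℝ) {ε : ℝ} (hε : 0 < ε) :
    Integrable (fun x => ∫ y in -Real.pi..Real.pi, truncatedDensity ν ε (x, y)) ∧
      ∫ ζ in strip 1 \ core 1 ε z, periodicDensity ν (ζ - z) (ζ - z) =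
        ∫ x, ∫ y in -Real.pi..Real.pi, truncatedDensity ν ε (x, y) := by
  have he : (fun ζ => truncatedDensity ν ε (ζ - z)) =
      (core 1 ε z)ᶜ.indicator fun ζ => periodicDensity ν (ζ - z) (ζ - z) := by
    ext ζ
    by_cases h : ζ ∈ core 1 ε z
    · rw [truncatedDensity, Set.indicator_of_notMem (by simpa using mem_core_iff.mp h),
        Set.indicator_of_notMem (by simpa using h)]
    · rw [truncatedDensity, Set.indicator_of_mem (by simpa using fun h' => h (mem_core_iff.mpr h')),
        Set.indicator_of_mem (by simpa using h)]
  have hm := (measurableSet_core 1 ε z).compl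
  have hint : IntegrableOn (fun ζ => truncatedDensity ν ε (ζ - z)) (strip 1) := by
    rw [he, IntegrableOn, integrable_indicator_iff hm, IntegrableOn, Measure.restrict_restrict hm,
      Set.inter_comm, ← Set.sdiff_eq]
    exact integrableOn_periodicDensity_self ν z hε
  obtain ⟨h1, h2⟩ := integral_strip_comp_sub
    (fun x y => truncatedDensity_add_two_pi ν ε x y) hint
  refine ⟨h1, ?_⟩
  rw [← h2, he, setIntegral_indicator hm, Set.sdiff_eq]

theorem integral_inv_sq_add_sq {ε : ℝ} (hε : 0 < ε) :
    Integrable (fun y : ℝ => (ε ^ 2 + y ^ 2)⁻¹) ∧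
      ∫ y : ℝ, (ε ^ 2 + y ^ 2)⁻¹ = Real.pi / ε := by
  have he : (fun y : ℝ => (ε ^ 2 + y ^ 2)⁻¹) =
      fun y => (ε ^ 2)⁻¹ * (1 + (y / ε) ^ 2)⁻¹ := by
    ext y
    rw [← mul_inv]
    congr 1
    field_simp
  rw [he]
  constructor
  · exact (integrable_inv_one_add_sq.comp_div hε.ne').const_mul _
  · rw [integral_const_mul, Measure.integral_comp_div (fun y : ℝ => (1 + y ^ 2)⁻¹),
      integral_univ_inv_one_add_sq, abs_of_pos hε, smul_eq_mul]
    field_simp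

/-- Outside the core ε² ≤ x² + y², so ε² + y² ≤ 2(x² + y²) and the density is dominated by a
multiple of 1 / (ε² + y²), with integral π / ε over the line. The factor 1 / ε is later cancelled by
the width 2ε of the slab. -/
theorem abs_integral_truncatedDensity_le (ν : ℝ) {ε : ℝ} (hε : 0 < ε) (x : ℝ) :
    |∫ y in -Real.pi..Real.pi, truncatedDensity ν ε (x, y)| ≤
      (|1 - 2 * ν| + 1) * Real.pi ^ 3 / ε := by
  have hpi := Real.pi_pos
  obtain ⟨hi, he⟩ := integral_inv_sq_add_sq hε
  have hK : 0 ≤ (|1 - 2 * ν| + 1) * Real.pi ^ 2 := by positivity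
  have hi' := hi.const_mul ((|1 - 2 * ν| + 1) * Real.pi ^ 2)
  have hb : ∀ y ∈ Set.Ioc (-Real.pi) Real.pi, ‖truncatedDensity ν ε (x, y)‖ ≤
      (|1 - 2 * ν| + 1) * Real.pi ^ 2 * (ε ^ 2 + y ^ 2)⁻¹ := fun y hy => by
    by_cases h : (x, y) ∈ core 1 ε 0
    · rw [truncatedDensity, Set.indicator_of_notMem (by simpa using h), norm_zero]
      positivity
    · rw [truncatedDensity, Set.indicator_of_mem (by simpa using h), Real.norm_eq_abs]
      have h1 := sq_add_sq_le_halfSinhNorm_sq (p := (x, y)) (abs_le.mpr ⟨hy.1.le, hy.2⟩)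
      have h2 : ε ^ 2 ≤ x ^ 2 + y ^ 2 := by
        by_contra! h'
        exact h ⟨0, by simpa [shift] using h'⟩
      refine (abs_periodicDensity_le ν _ _).trans ?_
      rw [mul_assoc]
      refine mul_le_mul_of_nonneg_left ?_ (by positivity)
      have h3 : (ε ^ 2 + y ^ 2) / Real.pi ^ 2 ≤ 4 * halfSinhNorm (x, y) ^ 2 := by
        have : (ε ^ 2 + y ^ 2) / Real.pi ^ 2 ≤ 2 * ((x ^ 2 + y ^ 2) / Real.pi ^ 2) := by
          rw [← mul_div_assoc]
          gcongr
          nlinarith [sq_nonneg x]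
        have h4 : (x ^ 2 + y ^ 2) / Real.pi ^ 2 ≤ halfSinhNorm (x, y) ^ 2 := h1
        nlinarith [sq_nonneg (halfSinhNorm (x, y))]
      calc 1 / (2 * halfSinhNorm (x, y)) * (1 / (2 * halfSinhNorm (x, y)))
          = (4 * halfSinhNorm (x, y) ^ 2)⁻¹ := by
            rw [one_div_mul_one_div, one_div]
            ring_nf
        _ ≤ ((ε ^ 2 + y ^ 2) / Real.pi ^ 2)⁻¹ := inv_anti₀ (by positivity) h3
        _ = _ := by rw [inv_div, div_eq_mul_inv]
  rw [intervalIntegral.integral_of_le (by linarith), ← Real.norm_eq_abs]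
  calc _ ≤ ∫ y in Set.Ioc (-Real.pi) Real.pi,
        (|1 - 2 * ν| + 1) * Real.pi ^ 2 * (ε ^ 2 + y ^ 2)⁻¹ :=
        norm_integral_le_of_norm_le hi'.integrableOn
          ((ae_restrict_iff' measurableSet_Ioc).mpr (Eventually.of_forall hb))
    _ ≤ ∫ y, (|1 - 2 * ν| + 1) * Real.pi ^ 2 * (ε ^ 2 + y ^ 2)⁻¹ :=
        setIntegral_le_integral hi' (Eventually.of_forall fun y => by positivity)
    _ = _ := by
      rw [integral_const_mul, he]
      field_simp

theorem integral_truncatedDensity_of_le (ν : ℝ) {ε : ℝ} {x : ℝ} (hε : 0 < ε)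
    (hx : ε ≤ |x|) :
    ∫ y in -Real.pi..Real.pi, truncatedDensity ν ε (x, y) = pairProfile ν 0 0 |x| := by
  have hx0 : x ≠ 0 := abs_pos.mp (hε.trans_le hx)
  have h := integral_periodicDensity_midpoint ν (t := x) (a := 0) (by simpa using hx0)
    (by simpa using hx0) 0
  rw [abs_zero, zero_div, if_pos (abs_pos.mpr hx0)] at h
  rw [← h]
  refine intervalIntegral.integral_congr fun y _ => ?_
  simp only [sub_zero, Prod.mk_zero_zero, add_zero]
  rw [truncatedDensity, Set.indicator_of_mem]
  rintro ⟨n, hn⟩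
  simp only [shift, Prod.fst_sub, Prod.snd_sub, sub_zero] at hn
  have : ε ^ 2 ≤ x ^ 2 := by
    rw [← sq_abs x]
    gcongr
  nlinarith [sq_nonneg (y - 2 * Real.pi * n * 1)]

/-- Behaviour of the self-interaction primitive near the core. -/
theorem abs_pairPrimitive_sub_log_le {ν ε : ℝ} (hν0 : 0 ≤ ν) (hν1 : ν < 1) (hε : 0 < ε)
    (hε1 : ε ≤ 1) :
    |2 * pairPrimitive ν 0 0 ε - 2 * Real.pi * (1 - ν) * Real.log ε| ≤
      2 * Real.pi * (Real.log (2 * Real.cosh 1) + 3) := by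
  have hpi := Real.pi_pos
  have hsinh : 0 < Real.sinh ε := Real.sinh_pos_iff.mpr hε
  have hD : Real.cosh (2 * ε) - Real.cos 0 = 2 * Real.sinh ε ^ 2 := by
    rw [Real.cos_zero, Real.cosh_two_mul]
    linear_combination Real.cosh_sq ε
  have hlow : ε ≤ Real.sinh ε := Real.self_le_sinh_iff.mpr hε.le
  -- Mean value theorem; the constant cosh 1 comes from ε ≤ 1.
  have hup : Real.sinh ε ≤ ε * Real.cosh 1 := by
    obtain ⟨ξ, hξ, h⟩ := exists_hasDerivAt_eq_slope Real.sinh Real.cosh hε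
      Real.continuous_sinh.continuousOn fun t _ => Real.hasDerivAt_sinh t
    rw [Real.sinh_zero, sub_zero, sub_zero, eq_div_iff hε.ne'] at h
    have : Real.cosh ξ ≤ Real.cosh 1 := by
      rw [Real.cosh_le_cosh, abs_one, abs_of_pos hξ.1]
      linarith [hξ.2]
    nlinarith
  have hQ : periodicPotential (2 * ε) 0 = Real.log (2 * Real.sinh ε) - ε := by
    rw [periodicPotential, hD, show 2 * (2 * Real.sinh ε ^ 2) = (2 * Real.sinh ε) ^ 2 by ring,
      Real.log_pow]
    push_cast
    ring
  have hQ1 : |periodicPotential (2 * ε) 0 - Real.log ε| ≤ Real.log (2 * Real.cosh 1) + 1 := by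
    have e : Real.log (2 * Real.sinh ε) - Real.log ε = Real.log (2 * (Real.sinh ε / ε)) := by
      rw [← Real.log_div (by positivity) hε.ne', mul_div_assoc]
    have h1 : 1 ≤ Real.sinh ε / ε := by rwa [one_le_div hε]
    have h2 : Real.sinh ε / ε ≤ Real.cosh 1 := by
      rw [div_le_iff₀ hε]
      linarith
    have h3 : 0 ≤ Real.log (2 * (Real.sinh ε / ε)) := Real.log_nonneg (by linarith)
    have h4 : Real.log (2 * (Real.sinh ε / ε)) ≤ Real.log (2 * Real.cosh 1) :=
      Real.log_le_log (by positivity) (by linarith)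
    rw [hQ, abs_le]
    constructor <;> linarith
  have hP : |ε * periodicPressure (2 * ε) 0| ≤ 1 := by
    have h1 : periodicPressure (2 * ε) 0 = Real.exp (-ε) / (2 * Real.sinh ε) := by
      rw [periodicPressure, hD, Real.sinh_two_mul, ← Real.cosh_sub_sinh]
      field_simp
    have h2 : Real.exp (-ε) ≤ 1 := Real.exp_le_one_iff.mpr (by linarith)
    rw [h1, abs_of_nonneg (by positivity), ← mul_div_assoc, div_le_one (by positivity)]
    nlinarith [Real.exp_pos (-ε)]
  have hR : |ε ^ 2 * periodicDipoleRe (2 * ε) 0| ≤ 1 := by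
    have h1 : periodicDipoleRe (2 * ε) 0 = -(1 / (4 * Real.sinh ε ^ 2)) := by
      rw [periodicDipoleRe, hD, Real.cos_zero, mul_one]
      rw [Real.cos_zero] at hD
      rw [show 1 - Real.cosh (2 * ε) = -(2 * Real.sinh ε ^ 2) by linarith]
      field_simp
      norm_num
    rw [h1, mul_neg, abs_neg, abs_of_nonneg (by positivity), mul_one_div,
      div_le_one (by positivity)]
    nlinarith
  -- The two occurrences of the potential combine to the coefficient 1 - ν, which carries the
  -- logarithm; the two other terms stay bounded.
  have e : 2 * pairPrimitive ν 0 0 ε - 2 * Real.pi * (1 - ν) * Real.log ε =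
      2 * Real.pi * ((1 - ν) * (periodicPotential (2 * ε) 0 - Real.log ε) +
        (ε ^ 2 * periodicDipoleRe (2 * ε) 0 - ε * periodicPressure (2 * ε) 0)) := by
    rw [pairPrimitive]
    ring
  rw [e, abs_mul, abs_of_pos (by positivity : 0 < 2 * Real.pi)]
  refine mul_le_mul_of_nonneg_left ?_ (by positivity)
  refine (abs_add_le _ _).trans ?_
  rw [abs_mul, abs_of_pos (by linarith : 0 < 1 - ν)]
  have h1 := abs_sub (ε ^ 2 * periodicDipoleRe (2 * ε) 0) (ε * periodicPressure (2 * ε) 0)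
  have h2 : (1 - ν) * |periodicPotential (2 * ε) 0 - Real.log ε| ≤
      |periodicPotential (2 * ε) 0 - Real.log ε| := by
    nlinarith [abs_nonneg (periodicPotential (2 * ε) 0 - Real.log ε)]
  linarith

/-- The line is cut at |x| = ε. The slab inside is O(1), and outside it vertical lines miss the
cores, so the tail is exactly -2 `pairPrimitive` at ε. -/
theorem abs_selfIntegral_add_log_le {ν ε : ℝ} (hν0 : 0 ≤ ν) (hν1 : ν < 1) (hε : 0 < ε)
    (hε1 : ε ≤ 1) (z : ℝ × ℝ) :
    |(∫ ζ in strip 1 \ core 1 ε z, periodicDensity ν (ζ - z) (ζ - z)) +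
        2 * Real.pi * (1 - ν) * Real.log ε| ≤
      2 * ((|1 - 2 * ν| + 1) * Real.pi ^ 3) + 2 * Real.pi * (Real.log (2 * Real.cosh 1) + 3) := by
  have hpi := Real.pi_pos
  obtain ⟨hi, he⟩ := integral_truncatedDensity ν z hε
  rw [he]
  set T : ℝ → ℝ := fun x => ∫ y in -Real.pi..Real.pi, truncatedDensity ν ε (x, y) with hT
  set f : ℝ → ℝ := (Set.Ioi ε).indicator (pairProfile ν 0 0) with hf
  have hms : MeasurableSet (Set.Icc (-ε) ε) := measurableSet_Icc
  have hsplit : T = (Set.Icc (-ε) ε).indicator T + fun x => f |x| := by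
    ext x
    by_cases hx : x ∈ Set.Icc (-ε) ε
    · have h1 : |x| ≤ ε := abs_le.mpr hx
      rw [Pi.add_apply, Set.indicator_of_mem hx, hf, Set.indicator_of_notMem (by simpa using h1),
        add_zero]
    · have h1 : ε < |x| := not_le.mp fun h => hx (abs_le.mp h)
      rw [Pi.add_apply, Set.indicator_of_notMem hx, hf, Set.indicator_of_mem (by simpa using h1),
        zero_add]
      exact integral_truncatedDensity_of_le ν hε h1.le
  have hi1 : Integrable ((Set.Icc (-ε) ε).indicator T) := hi.indicator hms
  have hi2 : Integrable fun x => f |x| := by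
    have : (fun x => f |x|) = T - (Set.Icc (-ε) ε).indicator T :=
      eq_sub_of_add_eq' hsplit.symm
    rw [this]
    exact hi.sub hi1
  have hi3 : IntegrableOn (pairProfile ν 0 0) (Set.Ioi ε) := by
    refine (hi2.integrableOn (s := Set.Ioi ε)).congr_fun (fun t ht => ?_) measurableSet_Ioi
    simp only [abs_of_pos (hε.trans (Set.mem_Ioi.mp ht)), hf]
    exact Set.indicator_of_mem ht _
  have hf2 : ∫ x, f |x| = -(2 * pairPrimitive ν 0 0 ε) := by
    rw [integral_comp_abs, hf, setIntegral_indicator measurableSet_Ioi,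
      Set.inter_eq_right.mpr (Set.Ioi_subset_Ioi hε.le), integral_Ioi_pairProfile ν 0 hε.le
        (cosh_sub_cos_pos (by positivity) 0) hi3]
    ring
  have hT2 : |∫ x, (Set.Icc (-ε) ε).indicator T x| ≤ 2 * ((|1 - 2 * ν| + 1) * Real.pi ^ 3) := by
    rw [integral_indicator hms, ← Real.norm_eq_abs]
    refine (norm_setIntegral_le_of_norm_le_const (C := (|1 - 2 * ν| + 1) * Real.pi ^ 3 / ε)
      (by simp) fun x _ => abs_integral_truncatedDensity_le ν hε x).trans (le_of_eq ?_)
    rw [Real.volume_real_Icc_of_le (by linarith)]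
    field_simp
    ring
  have hmain := abs_pairPrimitive_sub_log_le hν0 hν1 hε hε1
  have hTi : ∫ x, T x = (∫ x, (Set.Icc (-ε) ε).indicator T x) + ∫ x, f |x| := by
    conv_lhs => rw [hsplit]
    exact integral_add hi1 hi2
  rw [hTi, hf2]
  rw [abs_le] at hT2 hmain ⊢
  constructor <;> linarith [hT2.1, hT2.2, hmain.1, hmain.2]

end SelfEnergy

/-! ### Reduction to h = 1. -/

section Scaling

open scoped Pointwise

theorem inv_smul_strip_diff_core {h : ℝ} (hh : 0 < h) (ρ : ℝ) (z : ℝ × ℝ) :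
    h⁻¹ • (strip h \ core h ρ z) = strip 1 \ core 1 (ρ / h) (h⁻¹ • z) := by
  ext ζ
  rw [Set.mem_smul_set_iff_inv_smul_mem₀ (inv_ne_zero hh.ne'), inv_inv]
  have e1 : h • ζ ∈ strip h ↔ ζ ∈ strip 1 := by
    simp only [strip, Set.mem_ofPred_eq, Prod.smul_snd, smul_eq_mul, mul_one]
    rw [mul_comm Real.pi h, ← mul_neg, mul_le_mul_iff_right₀ hh, mul_lt_mul_iff_right₀ hh]
  have e2 : h • ζ ∈ core h ρ z ↔ ζ ∈ core 1 (ρ / h) (h⁻¹ • z) := by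
    refine exists_congr fun n => ?_
    have a1 : (h • ζ - z - shift h n).1 = h * (ζ - h⁻¹ • z - shift 1 n).1 := by
      simp [shift]
      field_simp
    have a2 : (h • ζ - z - shift h n).2 = h * (ζ - h⁻¹ • z - shift 1 n).2 := by
      simp [shift]
      field_simp
    rw [a1, a2, mul_pow, mul_pow, ← mul_add, div_pow, lt_div_iff₀ (by positivity), mul_comm]
  rw [Set.mem_sdiff, Set.mem_sdiff, e1, e2]

theorem inv_smul_strip {h : ℝ} (hh : 0 < h) : h⁻¹ • strip h = strip 1 := by
  -- A core of radius 0 is empty, so the statement is a case of the previous one.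
  have e : ∀ k : ℝ, core k 0 0 = ∅ := fun k => by
    ext ζ
    simp only [core, Set.mem_ofPred_eq, Set.mem_empty_iff_false, iff_false, not_exists, not_lt]
    intro n
    rw [zero_pow two_ne_zero]
    positivity
  have := inv_smul_strip_diff_core hh 0 0
  rwa [zero_div, smul_zero, e, e, Set.sdiff_empty, Set.sdiff_empty] at this

theorem measurableSet_strip (h : ℝ) : MeasurableSet (strip h) :=
  (measurableSet_le measurable_const measurable_snd).inter
    (measurableSet_lt measurable_snd measurable_const)

theorem integrableOn_comp_inv_smul {h : ℝ} (hh : 0 < h) {s : Set (ℝ × ℝ)} (hs : MeasurableSet s)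
    {F : ℝ × ℝ → ℝ} (hF : IntegrableOn F (h⁻¹ • s)) : IntegrableOn (fun ζ => F (h⁻¹ • ζ)) s := by
  have hh' := inv_ne_zero hh.ne'
  rw [← integrable_indicator_iff (hs.const_smul₀ h⁻¹), ← integrable_comp_smul_iff volume _ hh'] at hF
  rw [← integrable_indicator_iff hs]
  refine hF.congr (Eventually.of_forall fun ζ => ?_)
  by_cases hζ : ζ ∈ s
  · simp only
    rw [Set.indicator_of_mem ((Set.smul_mem_smul_set_iff₀ hh' _ _).mpr hζ),
      Set.indicator_of_mem hζ]
  · simp only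
    rw [Set.indicator_of_notMem fun h => hζ ((Set.smul_mem_smul_set_iff₀ hh' _ _).mp h),
      Set.indicator_of_notMem hζ]

theorem setIntegral_comp_inv_smul {h : ℝ} (hh : 0 < h) (s : Set (ℝ × ℝ)) (F : ℝ × ℝ → ℝ) :
    ∫ ζ in s, F (h⁻¹ • ζ) = h ^ 2 * ∫ ζ in h⁻¹ • s, F ζ := by
  rw [Measure.setIntegral_comp_smul_of_pos volume F s (inv_pos.mpr hh)]
  simp

/-- The closed form can fail only on the vertical lines through z and z', a null set. -/
theorem qPer_ae_eq (b μ ν : ℝ) (hν : ν < 1) {h : ℝ} (hh : 0 < h) (z z' : ℝ × ℝ) :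
    qPer b μ ν h z z' =ᵐ[volume] fun ζ => gamma0 b μ ν * b / (2 * Real.pi * (1 - ν)) / h ^ 2 *
      periodicDensity ν (h⁻¹ • ζ - h⁻¹ • z) (h⁻¹ • ζ - h⁻¹ • z') := by
  have a := fun c : ℝ => Measure.quasiMeasurePreserving_fst (μ := (volume : Measure ℝ))
      (ν := (volume : Measure ℝ)) |>.ae (ae_ne_real c)
  rw [Measure.volume_eq_prod]
  filter_upwards [a z.1, a z'.1] with ζ h1 h2
  rw [qPer_eq b μ ν hν hh h1 fun n hn => h2 (by rw [hn]; simp [shift]), smul_sub, smul_sub]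
  ring

/-- N vanishes only at multiples of the period. Two points of the half-open strip differ vertically
by less than 2πh, so distinct ones are not congruent. -/
theorem halfSinhNorm_inv_smul_sub_ne_zero {h : ℝ} (hh : 0 < h) {z z' : ℝ × ℝ}
    (hz : z ∈ strip h) (hz' : z' ∈ strip h) (hne : z ≠ z') :
    halfSinhNorm (h⁻¹ • z - h⁻¹ • z') ≠ 0 := by
  intro h0
  have h1 := halfSinhNorm_sq (h⁻¹ • z - h⁻¹ • z')
  rw [h0] at h1
  have h2 : Real.sinh ((h⁻¹ • z - h⁻¹ • z').1 / 2) = 0 := by nlinarith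
  have h3 : Real.sin ((h⁻¹ • z - h⁻¹ • z').2 / 2) = 0 := by nlinarith
  rw [Real.sinh_eq_zero] at h2
  have hlt : |(h⁻¹ • z - h⁻¹ • z').2 / 2| < Real.pi := by
    have e : (h⁻¹ • z - h⁻¹ • z').2 / 2 = (z.2 - z'.2) / (2 * h) := by
      simp only [Prod.snd_sub, Prod.smul_snd, smul_eq_mul]
      field_simp
    rw [e, abs_div, abs_of_pos (by positivity : 0 < 2 * h), div_lt_iff₀ (by positivity), abs_lt]
    constructor <;> linarith [hz.1, hz.2, hz'.1, hz'.2]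
  rw [Real.sin_eq_zero_iff_of_lt_of_lt (abs_lt.mp hlt).1 (abs_lt.mp hlt).2] at h3
  simp only [Prod.fst_sub, Prod.snd_sub, Prod.smul_fst, Prod.smul_snd, smul_eq_mul, ← mul_sub]
    at h2 h3
  have hh' := hh.ne'
  refine hne (Prod.ext ?_ ?_)
  · field_simp at h2
    linarith
  · field_simp at h3
    linarith

end Scaling

end EdgeDislocation

/-! ### The main theorem. -/

theorem mainTheorem3 (b μ ν : ℝ) (hb : 0 < b) (hμ : 0 < μ) (hν0 : 0 ≤ ν) (hν1 : ν < 1) :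
    -- the double series defining the periodized density converges off the cores and the cut line
    (∀ h : ℝ, 0 < h → ∀ z z' ζ : ℝ × ℝ, ζ.1 ≠ z.1 →
      (∀ n : ℤ, ζ ≠ z' + EdgeDislocation.shift h n) →
        Tendsto (EdgeDislocation.qPartial b μ ν h z z' ζ) atTop
          (𝓝 (EdgeDislocation.qPer b μ ν h z z' ζ))) ∧
    -- the self-energy, with core radius `b`
    (∀ h : ℝ, 0 < h → ∀ z ∈ EdgeDislocation.strip h,
      IntegrableOn (EdgeDislocation.qPer b μ ν h z z)
        (EdgeDislocation.strip h \ EdgeDislocation.core h b z)) ∧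
    (∃ C h₀ : ℝ, 0 < h₀ ∧ ∀ h : ℝ, h₀ ≤ h → ∀ z ∈ EdgeDislocation.strip h,
      |EdgeDislocation.Uself b μ ν b h z
          - EdgeDislocation.gamma0 b μ ν * b / (2 * Real.pi * h) * Real.log h|
        ≤ EdgeDislocation.gamma0 b μ ν * b / (2 * Real.pi * h) * C) ∧
    -- the interaction energy
    (∀ h : ℝ, 0 < h → ∀ z ∈ EdgeDislocation.strip h, ∀ z' ∈ EdgeDislocation.strip h, z ≠ z' →
      IntegrableOn (EdgeDislocation.qPer b μ ν h z z') (EdgeDislocation.strip h) ∧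
      EdgeDislocation.Uint b μ ν h z z' =
        EdgeDislocation.gamma0 b μ ν * b / (2 * Real.pi * h) *
          EdgeDislocation.W 1 ((z.1 - z'.1) / h) ((z.2 - z'.2) / h)) := by
  have hpi := Real.pi_pos
  have hν : 0 < 1 - ν := by linarith
  have hγ : 0 < EdgeDislocation.gamma0 b μ ν := by
    rw [EdgeDislocation.gamma0]
    positivity
  refine ⟨fun h hh z z' ζ hz hz' => ?_, fun h hh z _ => ?_, ?_, fun h hh z hz z' hz' hne => ?_⟩
  · rw [EdgeDislocation.qPer_eq b μ ν hν1 hh hz hz']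
    exact EdgeDislocation.tendsto_qPartial b μ ν hν1 hh hz hz'
  · have hF := EdgeDislocation.integrableOn_periodicDensity_self ν (h⁻¹ • z) (div_pos hb hh)
    rw [← EdgeDislocation.inv_smul_strip_diff_core hh] at hF
    have hs := (EdgeDislocation.measurableSet_strip h).diff
      (EdgeDislocation.measurableSet_core h b z)
    exact ((EdgeDislocation.integrableOn_comp_inv_smul hh hs hF).const_mul _).congr
      (ae_restrict_of_ae (EdgeDislocation.qPer_ae_eq b μ ν hν1 hh z z).symm)
  · set M : ℝ := 2 * ((|1 - 2 * ν| + 1) * Real.pi ^ 3) +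
      2 * Real.pi * (Real.log (2 * Real.cosh 1) + 3) with hM
    -- The choice h₀ = b gives ε = b / h ≤ 1. The term |log b| accounts for log(b / h) = log b - log
    -- h.
    refine ⟨M / (2 * Real.pi * (1 - ν)) + |Real.log b|, b, hb, fun h hbh z _ => ?_⟩
    have hh : 0 < h := hb.trans_le hbh
    have hε : 0 < b / h := div_pos hb hh
    have key := EdgeDislocation.abs_selfIntegral_add_log_le hν0 hν1 hε
      ((div_le_one hh).mpr hbh) (h⁻¹ • z)
    rw [← hM] at key
    set I := ∫ ζ in EdgeDislocation.strip 1 \ EdgeDislocation.core 1 (b / h) (h⁻¹ • z),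
      EdgeDislocation.periodicDensity ν (ζ - h⁻¹ • z) (ζ - h⁻¹ • z) with hI
    -- The Jacobian h² of the rescaling cancels the factor 1 / h² of the density.
    have hU : EdgeDislocation.Uself b μ ν b h z = EdgeDislocation.gamma0 b μ ν * b /
        (2 * Real.pi * h) * (I / (2 * Real.pi * (1 - ν))) := by
      rw [EdgeDislocation.Uself, integral_congr_ae
        (ae_restrict_of_ae (EdgeDislocation.qPer_ae_eq b μ ν hν1 hh z z)), integral_const_mul,
        EdgeDislocation.setIntegral_comp_inv_smul hh _ (fun ζ =>
          EdgeDislocation.periodicDensity ν (ζ - h⁻¹ • z) (ζ - h⁻¹ • z)),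
        EdgeDislocation.inv_smul_strip_diff_core hh, ← hI]
      field_simp
    rw [hU, ← mul_sub, abs_mul, abs_of_pos (by positivity)]
    refine mul_le_mul_of_nonneg_left ?_ (by positivity)
    have e : I / (2 * Real.pi * (1 - ν)) - Real.log h =
        (I + 2 * Real.pi * (1 - ν) * Real.log (b / h)) / (2 * Real.pi * (1 - ν)) -
          Real.log b := by
      rw [Real.log_div hb.ne' hh.ne']
      field_simp
      ring
    rw [e]
    refine (abs_sub _ _).trans (add_le_add ?_ le_rfl)
    rw [abs_div, abs_of_pos (by positivity : 0 < 2 * Real.pi * (1 - ν))]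
    gcongr
  · have hN := EdgeDislocation.halfSinhNorm_inv_smul_sub_ne_zero hh hz hz' hne
    have hae := EdgeDislocation.qPer_ae_eq b μ ν hν1 hh z z'
    constructor
    · have hF := EdgeDislocation.integrableOn_periodicDensity ν hN
      rw [← EdgeDislocation.inv_smul_strip hh] at hF
      exact ((EdgeDislocation.integrableOn_comp_inv_smul hh
        (EdgeDislocation.measurableSet_strip h) hF).const_mul _).congr
        (ae_restrict_of_ae hae.symm)
    · rw [EdgeDislocation.Uint, integral_congr_ae (ae_restrict_of_ae hae), integral_const_mul,
        EdgeDislocation.setIntegral_comp_inv_smul hh _ (fun ζ =>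
          EdgeDislocation.periodicDensity ν (ζ - h⁻¹ • z) (ζ - h⁻¹ • z')),
        EdgeDislocation.inv_smul_strip hh, EdgeDislocation.setIntegral_periodicDensity ν hN]
      simp only [Prod.smul_fst, Prod.smul_snd, smul_eq_mul, inv_mul_eq_div, ← sub_div]
      field_simp
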